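/- Let $r\ge 3$, let $F_r$ be the free group with basis $A=\{a_1,\dots,a_r\}$, and let $\mathrm{Out}(F_r)=\mathrm{Aut}(F_r)/\mathrm{Inn}(F_r)$. Let $S$ be the set of the $4r(r-1)$ standard Nielsen automorphisms $\theta=[x\mapsto yx]$ of $F_r$, where $x,y\in A^{\pm1}$, $y\neq x^{\pm1}$, $\theta(x)=yx$, and $\theta(z)=z$ for all $z\in A^{\pm1}\setminus\{x,x^{-1}\}$. Call an ordered pair $([x\mapsto yx],[x'\mapsto y'x'])$ of elements of $S$ admissible if either $x'=x$ and $y'\neq y^{-1}$, or $y'=x$ and $x'\neq y^{-1}$; for each $\theta\in S$ there are exactly $4r-6$ elements $\theta'\in S$ such that $(\theta,\theta')$ is admissible. Let $\mu_{\mathcal W}$ be the probability measure on $S^{\mathbb N}$ that is the law of the Markov chain $\theta_1,\theta_2,\dots$ on $S$ with $\theta_1$ uniformly distributed on $S$ and with transition probabilities $P(\theta'|\theta)=\frac1{4r-6}$ if $(\theta,\theta')$ is admissible and $P(\theta'|\theta)=0$ otherwise. Let $Q=Q^{-1}$ be a finite generating set of $\mathrm{Out}(F_r)$, and for $\varphi\in\mathrm{Out}(F_r)$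 let $|\varphi|_Q$ be the smallest $n\ge 0$ such that $\varphi$ is a product of $n$ elements of $Q$. Then there is a constant $c>0$ such that, for $\mu_{\mathcal W}$-a.e. trajectory $\theta_1,\theta_2,\dots$, \[ \lim_{n\to\infty}\frac1n\,|\theta_n\cdots\theta_1|_Q=c, \] where $\theta_n\cdots\theta_1$ denotes the class of $\theta_n\circ\cdots\circ\theta_1$ in $\mathrm{Out}(F_r)$. -/

import Mathlib

open Filter Topology MeasureTheory ProbabilityTheory
open scoped ENNReal

/-! ### Outer automorphism groups and word length -/

/-- The subgroup of inner automorphisms of a group is normal. -/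
instance innerAut_normal (G : Type*) [Group G] :
    ((MulAut.conj : G →* MulAut G).range).Normal where
  conj_mem := by
    rintro _ ⟨g, rfl⟩ f
    refine ⟨f g, ?_⟩
    ext z
    simp [MulAut.mul_apply, MulAut.conj_apply]

/-- `Out(G) = Aut(G) / Inn(G)`; the product of automorphisms is composition, `(f * g) z = f (g z)`. -/
abbrev OuterAut (G : Type*) [Group G] : Type _ :=
  MulAut G ⧸ (MulAut.conj : G →* MulAut G).range

/-- The word length `|g|_Q`: the least `n` such that `g` is a product of `n` elements of `Q`.
(It is used only for sets `Q = Q⁻¹` that generate the group, for which such an `n` exists.) -/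
noncomputable def wordLength {G : Type*} [Group G] (Q : Set G) (g : G) : ℕ :=
  sInf {n : ℕ | ∃ l : List G, l.length = n ∧ (∀ q ∈ l, q ∈ Q) ∧ l.prod = g}

/-! ### Standard Nielsen automorphisms and admissible pairs -/

/-- The letters `A^{±1}` of the basis `A = {a_1, …, a_r}` of `F_r`: `(i, true)` is `a_i` and
`(i, false)` is `a_i⁻¹`. -/
abbrev Letter (r : ℕ) : Type := Fin r × Bool

namespace Letter

/-- The inverse letter. -/
def inv {r : ℕ} (x : Letter r) : Letter r := (x.1, !x.2)

/-- The element of `F_r` given by a letter. -/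
def toFree {r : ℕ} (x : Letter r) : FreeGroup (Fin r) :=
  if x.2 then FreeGroup.of x.1 else (FreeGroup.of x.1)⁻¹

theorem toFree_inv {r : ℕ} (x : Letter r) : x.inv.toFree = x.toFree⁻¹ := by
  obtain ⟨i, b⟩ := x
  cases b <;> simp [toFree, inv]

theorem toFree_eq_mk {r : ℕ} (x : Letter r) : x.toFree = FreeGroup.mk [x] := by
  obtain ⟨i, b⟩ := x
  cases b <;> simp [toFree, FreeGroup.of, FreeGroup.inv_mk, FreeGroup.invRev]

theorem fst_ne_iff {r : ℕ} (x y : Letter r) : y.1 ≠ x.1 ↔ y ≠ x ∧ y ≠ x.inv := by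
  obtain ⟨i, b⟩ := x
  obtain ⟨j, c⟩ := y
  cases b <;> cases c <;> simp [inv]

end Letter

/-- The set `S` of standard Nielsen automorphisms `[x ↦ y x]`, each given by its characteristic
pair `(x, y)` of letters with `y ≠ x^{±1}`. -/
abbrev Nielsen (r : ℕ) : Type := {p : Letter r × Letter r // p.2 ≠ p.1 ∧ p.2 ≠ p.1.inv}

namespace Nielsen

/-- The letter `x` of `[x ↦ y x]`. -/
def x {r : ℕ} (θ : Nielsen r) : Letter r := θ.1.1

/-- The letter `y` of `[x ↦ y x]`. -/
def y {r : ℕ} (θ : Nielsen r) : Letter r := θ.1.2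

theorem y_fst_ne {r : ℕ} (θ : Nielsen r) : θ.y.1 ≠ θ.x.1 := (Letter.fst_ne_iff _ _).2 θ.2

/-- The endomorphism of `F_r` with `x ↦ w x` (hence `x⁻¹ ↦ x⁻¹ w⁻¹`) that fixes the other
basis elements. -/
def endo {r : ℕ} (x : Letter r) (w : FreeGroup (Fin r)) :
    FreeGroup (Fin r) →* FreeGroup (Fin r) :=
  FreeGroup.lift fun i =>
    if i = x.1 then (if x.2 then w * FreeGroup.of i else FreeGroup.of i * w⁻¹)
    else FreeGroup.of i

theorem endo_letter {r : ℕ} (x z : Letter r) (w : FreeGroup (Fin r)) (h : z.1 ≠ x.1) :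
    endo x w z.toFree = z.toFree := by
  obtain ⟨j, c⟩ := z
  cases c <;> simp_all [endo, Letter.toFree]

theorem endo_self {r : ℕ} (x : Letter r) (w : FreeGroup (Fin r)) :
    endo x w x.toFree = w * x.toFree := by
  obtain ⟨j, c⟩ := x
  cases c <;> simp [endo, Letter.toFree]

theorem endo_endo {r : ℕ} (x : Letter r) (v w : FreeGroup (Fin r)) (h : endo x v w = w) :
    (endo x v).comp (endo x w) = endo x (w * v) := by
  refine FreeGroup.ext_hom _ _ fun i => ?_
  obtain ⟨j, c⟩ := x
  by_cases hi : i = j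
  · subst hi
    cases c
    · have : endo (i, false) v (FreeGroup.of i) = FreeGroup.of i * v⁻¹ := by simp [endo]
      have h2 : endo (i, false) w (FreeGroup.of i) = FreeGroup.of i * w⁻¹ := by simp [endo]
      have h3 : endo (i, false) (w * v) (FreeGroup.of i) = FreeGroup.of i * (w * v)⁻¹ := by
        simp [endo]
      rw [MonoidHom.comp_apply, h2, h3, map_mul, map_inv, h, this]
      group
    · have : endo (i, true) v (FreeGroup.of i) = v * FreeGroup.of i := by simp [endo]
      have h2 : endo (i, true) w (FreeGroup.of i) = w * FreeGroup.of i := by simp [endo]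
      have h3 : endo (i, true) (w * v) (FreeGroup.of i) = w * v * FreeGroup.of i := by
        simp [endo]
      rw [MonoidHom.comp_apply, h2, h3, map_mul, h, this]
      group
  · simp [endo, hi]

theorem endo_one {r : ℕ} (x : Letter r) : endo x 1 = MonoidHom.id _ := by
  refine FreeGroup.ext_hom _ _ fun i => ?_
  simp [endo]

/-- The automorphism `[x ↦ y x]` of `F_r`. -/
def toAut {r : ℕ} (θ : Nielsen r) : MulAut (FreeGroup (Fin r)) :=
  MonoidHom.toMulEquiv (endo θ.x θ.y.toFree) (endo θ.x θ.y.toFree⁻¹)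
    (by rw [endo_endo, mul_inv_cancel, endo_one]; exact endo_letter _ _ _ θ.y_fst_ne)
    (by
      rw [endo_endo, inv_mul_cancel, endo_one]
      rw [map_inv, endo_letter _ _ _ θ.y_fst_ne])

/-- The defining property of `[x ↦ y x]`. -/
theorem toAut_spec {r : ℕ} (θ : Nielsen r) :
    θ.toAut θ.x.toFree = θ.y.toFree * θ.x.toFree ∧
      ∀ z : Letter r, z ≠ θ.x → z ≠ θ.x.inv → θ.toAut z.toFree = z.toFree :=
  ⟨endo_self _ _, fun _ h1 h2 => endo_letter _ _ _ ((Letter.fst_ne_iff _ _).2 ⟨h1, h2⟩)⟩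

/-- The automorphisms `θ.toAut` are exactly the standard Nielsen automorphisms of `F_r`. -/
theorem exists_toAut_eq_iff {r : ℕ} (Φ : MulAut (FreeGroup (Fin r))) :
    (∃ θ : Nielsen r, θ.toAut = Φ) ↔
      ∃ x y : Letter r, y ≠ x ∧ y ≠ x.inv ∧ Φ x.toFree = y.toFree * x.toFree ∧
        ∀ z : Letter r, z ≠ x → z ≠ x.inv → Φ z.toFree = z.toFree := by
  constructor
  · rintro ⟨θ, rfl⟩
    exact ⟨θ.x, θ.y, θ.2.1, θ.2.2, θ.toAut_spec⟩
  · rintro ⟨x, y, h1, h2, h3, h4⟩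
    refine ⟨⟨(x, y), h1, h2⟩, ?_⟩
    have key := toAut_spec (⟨(x, y), h1, h2⟩ : Nielsen r)
    set θ : Nielsen r := ⟨(x, y), h1, h2⟩
    have hx : θ.toAut x.toFree = Φ x.toFree := by rw [h3]; exact key.1
    have hom : θ.toAut.toMonoidHom = Φ.toMonoidHom := by
      refine FreeGroup.ext_hom _ _ fun i => ?_
      change θ.toAut (FreeGroup.of i) = Φ (FreeGroup.of i)
      by_cases hi : i = x.1
      · subst hi
        obtain ⟨j, c⟩ := x
        cases c
        · have := hx
          simp only [Letter.toFree, Bool.false_eq_true, if_false, map_inv, inv_inj] at this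
          exact this
        · simpa [Letter.toFree] using hx
      · have hne := (Letter.fst_ne_iff x (i, true)).1 hi
        have e1 := key.2 (i, true) hne.1 hne.2
        have e2 := h4 (i, true) hne.1 hne.2
        simp only [Letter.toFree, if_true] at e1 e2
        rw [e1, e2]
    exact MulEquiv.ext fun z => DFunLike.congr_fun hom z

/-- Different characteristic pairs give different automorphisms. -/
theorem toAut_injective {r : ℕ} : Function.Injective (toAut (r := r)) := by
  intro θ θ' h
  have inj : ∀ z w : Letter r, z.toFree = w.toFree → z = w := by
    intro z w hzw
    rw [Letter.toFree_eq_mk, Letter.toFree_eq_mk] at hzw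
    have := congrArg FreeGroup.toWord hzw
    simpa [FreeGroup.toWord_mk, FreeGroup.reduce.cons] using this
  have hy : θ.y.toFree ≠ 1 := by
    rw [Letter.toFree_eq_mk]
    intro h1
    have := congrArg FreeGroup.toWord h1
    simp [FreeGroup.toWord_mk, FreeGroup.reduce.cons] at this
  have s := θ.toAut_spec
  have s' := θ'.toAut_spec
  rw [← h] at s'
  have hx : θ.x = θ'.x ∨ θ.x = θ'.x.inv := by
    by_contra hne
    push Not at hne
    have := s'.2 _ hne.1 hne.2
    rw [s.1] at this
    exact hy (by simpa using this)
  rcases hx with hx | hx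
  · have hyy : θ.y = θ'.y := by
      refine inj _ _ ?_
      have := s'.1
      rw [← hx, s.1] at this
      simpa using this
    exact Subtype.ext (Prod.ext hx hyy)
  · exfalso
    have h1 := s'.1
    have hinv : θ'.x.toFree = θ.x.toFree⁻¹ := by rw [hx, Letter.toFree_inv, inv_inv]
    rw [hinv, map_inv, s.1, mul_inv_rev] at h1
    have hy' := θ.y_fst_ne
    have hyx : θ'.y.1 ≠ θ.x.1 := by rw [hx]; exact θ'.y_fst_ne
    have h2 : (θ'.y.toFree : FreeGroup (Fin r)) * θ.x.toFree⁻¹ = θ.x.toFree⁻¹ * θ.y.toFree⁻¹ :=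
      h1.symm
    rw [← Letter.toFree_inv, ← Letter.toFree_inv, Letter.toFree_eq_mk, Letter.toFree_eq_mk,
      Letter.toFree_eq_mk, FreeGroup.mul_mk, FreeGroup.mul_mk] at h2
    have h3 := congrArg FreeGroup.toWord h2
    have a1 : ¬ (θ'.y.1 = θ.x.inv.1 ∧ θ'.y.2 = !θ.x.inv.2) := fun h => hyx h.1
    have a2 : ¬ (θ.x.inv.1 = θ.y.inv.1 ∧ θ.x.inv.2 = !θ.y.inv.2) := fun h => hy' h.1.symm
    simp only [FreeGroup.toWord_mk, FreeGroup.reduce.cons, FreeGroup.reduce_nil, List.cons_append,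
      List.nil_append, a1, a2, if_false, List.cons.injEq, and_true] at h3
    have h4 := congrArg Prod.fst h3.1
    exact hyx h4

/-- The ordered pair `(θ, θ')` with `θ = [x ↦ y x]`, `θ' = [x' ↦ y' x']` is admissible. -/
def Admissible {r : ℕ} (θ θ' : Nielsen r) : Prop :=
  (θ'.x = θ.x ∧ θ'.y ≠ θ.y.inv) ∨ (θ'.y = θ.x ∧ θ'.x ≠ θ.y.inv)

instance {r : ℕ} (θ θ' : Nielsen r) : Decidable (Admissible θ θ') := by
  unfold Admissible; infer_instance

/-- There are `4r(r-1)` standard Nielsen automorphisms. -/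
theorem card_eq (r : ℕ) : Fintype.card (Nielsen r) = 4 * r * (r - 1) := by
  have key : ∀ x : Letter r,
      (∑ y : Letter r, if y ≠ x ∧ y ≠ x.inv then 1 else 0) = 2 * (r - 1) := by
    intro x
    rw [← Finset.card_filter]
    have h1 : (Finset.univ.filter fun y : Letter r => y ≠ x ∧ y ≠ x.inv)
        = Finset.univ \ {x, x.inv} := by
      ext y; simp
    have h2 : x ≠ x.inv := by
      obtain ⟨i, b⟩ := x
      cases b <;> simp [Letter.inv]
    rw [h1, Finset.card_sdiff_of_subset (Finset.subset_univ _), Finset.card_pair h2,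
      Finset.card_univ, Fintype.card_prod, Fintype.card_fin, Fintype.card_bool]
    omega
  rw [Fintype.card_subtype, Finset.card_filter, Fintype.sum_prod_type]
  simp only [key]
  rw [Finset.sum_const, Finset.card_univ, Fintype.card_prod, Fintype.card_fin, Fintype.card_bool,
    smul_eq_mul]
  ring

/-- Every state has exactly `4r-6` admissible successors. -/
theorem card_admissible {r : ℕ} (θ : Nielsen r) :
    (Finset.univ.filter fun θ' => Admissible θ θ').card = 4 * r - 6 := by
  obtain ⟨⟨x, y⟩, h1, h2⟩ := θ
  have h1 : y ≠ x := h1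
  have h2 : y ≠ x.inv := h2
  have inv_inv : ∀ z : Letter r, z.inv.inv = z := fun z => by simp [Letter.inv]
  have hx : x ≠ x.inv := by
    obtain ⟨i, b⟩ := x
    cases b <;> simp [Letter.inv]
  have hxy : x ≠ y.inv := fun e => h2 (by rw [e, inv_inv])
  have hxy' : x.inv ≠ y.inv := fun e => h1 (by rw [← inv_inv x, e, inv_inv])
  set T : Finset (Letter r) := Finset.univ \ {x, x.inv, y.inv}
  have hT : T.card = 2 * r - 3 := by
    rw [Finset.card_sdiff_of_subset (Finset.subset_univ _), Finset.card_univ, Fintype.card_prod,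
      Fintype.card_fin, Fintype.card_bool, Finset.card_eq_three.2 ⟨x, x.inv, y.inv, hx, hxy, hxy', rfl⟩]
    omega
  have hmem : ∀ z, z ∈ T ↔ z ≠ x ∧ z ≠ x.inv ∧ z ≠ y.inv := by
    intro z; simp [T]
  have hu : ((Finset.univ.filter fun θ' => Admissible ⟨(x, y), h1, h2⟩ θ').map
      (Function.Embedding.subtype _)) = T.image (fun z => (x, z)) ∪ T.image (fun z => (z, x)) := by
    ext ⟨a, b⟩
    simp only [Finset.mem_map, Finset.mem_filter, Finset.mem_univ, true_and,
      Function.Embedding.coe_subtype, Finset.mem_union, Finset.mem_image, hmem, Prod.mk.injEq]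
    constructor
    · rintro ⟨⟨⟨a', b'⟩, k1, k2⟩, k3, k4⟩
      simp only [Prod.mk.injEq] at k4
      obtain ⟨rfl, rfl⟩ := k4
      simp only [Admissible, Nielsen.x, Nielsen.y] at k3
      rcases k3 with ⟨rfl, k⟩ | ⟨rfl, k⟩
      · exact Or.inl ⟨b', ⟨k1, k2, k⟩, rfl, rfl⟩
      · exact Or.inr ⟨a', ⟨k1.symm, fun e => k2 (by rw [e, inv_inv]), k⟩, rfl, rfl⟩
    · rintro (⟨z, ⟨k1, k2, k3⟩, rfl, rfl⟩ | ⟨z, ⟨k1, k2, k3⟩, rfl, rfl⟩)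
      · exact ⟨⟨(x, z), k1, k2⟩, Or.inl ⟨rfl, k3⟩, rfl⟩
      · exact ⟨⟨(z, x), k1.symm, fun e => k2 (by rw [show x = z.inv from e, inv_inv])⟩,
          Or.inr ⟨rfl, k3⟩, rfl⟩
  have hd : Disjoint (T.image (fun z => (x, z))) (T.image (fun z => (z, x))) := by
    rw [Finset.disjoint_left]
    rintro ⟨a, b⟩ ha hb
    simp only [Finset.mem_image, hmem, Prod.mk.injEq] at ha hb
    obtain ⟨z, ⟨k, -⟩, -, rfl⟩ := ha
    obtain ⟨w, -, -, e⟩ := hb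
    exact k e.symm
  rw [← Finset.card_map (Function.Embedding.subtype _), hu, Finset.card_union_of_disjoint hd,
    Finset.card_image_of_injective _ (fun a b h => (Prod.mk.inj h).2),
    Finset.card_image_of_injective _ (fun a b h => (Prod.mk.inj h).1), hT]
  omega

end Nielsen

/-! ### The Markov chain, the law of the walk, and the walk in `Out(F_r)` -/

/-- The transition probability `P(θ' | θ)`: it is `1/(4r-6)` if `(θ, θ')` is admissible and `0`
otherwise. -/
noncomputable def transProb {r : ℕ} (θ θ' : Nielsen r) : ℝ≥0∞ :=
  if Nielsen.Admissible θ θ' then ((4 * r - 6 : ℕ) : ℝ≥0∞)⁻¹ else 0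

theorem two_le_of_nielsen {r : ℕ} (θ : Nielsen r) : 2 ≤ r := by
  have h := θ.y_fst_ne
  have h1 := θ.x.1.isLt
  have h2 := θ.y.1.isLt
  have h3 : (θ.y.1 : ℕ) ≠ θ.x.1 := fun e => h (Fin.ext e)
  omega

theorem sum_transProb {r : ℕ} (θ : Nielsen r) : ∑ θ', transProb θ θ' = 1 := by
  have h2 := two_le_of_nielsen θ
  simp only [transProb]
  rw [← Finset.sum_filter, Finset.sum_const, Nielsen.card_admissible, nsmul_eq_mul]
  exact ENNReal.mul_inv_cancel (Nat.cast_ne_zero.2 (by omega)) (ENNReal.natCast_ne_top _)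

/-- The law of the next state, given the present state. -/
noncomputable def nextState {r : ℕ} (θ : Nielsen r) : PMF (Nielsen r) :=
  PMF.ofFintype (transProb θ) (sum_transProb θ)

/-- The transition probabilities as a Markov kernel from the past `θ_1, …, θ_{n+1}` to the next
state; it depends only on the present state `θ_{n+1}`. -/
noncomputable def transKernel (r n : ℕ) :
    Kernel ((i : Finset.Iic n) → (fun _ : ℕ => Nielsen r) i) (Nielsen r) :=
  Kernel.ofFunOfCountable fun h => (nextState (h ⟨n, Finset.mem_Iic.2 le_rfl⟩)).toMeasure

instance (r n : ℕ) : IsMarkovKernel (transKernel r n) where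
  isProbabilityMeasure _ := PMF.toMeasure.isProbabilityMeasure _

/-- The law `μ_𝒲` on `S^ℕ` of the Markov chain with the above transition probabilities, started
from the uniform distribution on `S`; a trajectory `θ_1, θ_2, …` is `ω 0, ω 1, …`. -/
noncomputable def walkMeasure (r : ℕ) : Measure (ℕ → Nielsen r) :=
  Kernel.trajMeasure (X := fun _ => Nielsen r) (uniformOn Set.univ) (transKernel r)

/-- `walk ω n` is the element `θ_n ∘ ⋯ ∘ θ_1` of `Out(F_r)`. -/
def walk {r : ℕ} (ω : ℕ → Nielsen r) : ℕ → OuterAut (FreeGroup (Fin r))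
  | 0 => 1
  | n + 1 => ((ω n).toAut : OuterAut (FreeGroup (Fin r))) * walk ω n

theorem isProbabilityMeasure_walkMeasure {r : ℕ} (hr : 2 ≤ r) :
    IsProbabilityMeasure (walkMeasure r) := by
  have : Nonempty (Nielsen r) :=
    ⟨⟨((⟨0, by omega⟩, true), (⟨1, by omega⟩, true)), by simp, by simp [Letter.inv]⟩⟩
  unfold walkMeasure
  infer_instance

/-- The finite-dimensional distributions of `μ_𝒲`. -/
theorem walkMeasure_cylinder {r : ℕ} (hr : 2 ≤ r) (s : ℕ → Nielsen r) (n : ℕ) :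
    walkMeasure r {ω | ∀ i ≤ n, ω i = s i} =
      ((4 * r * (r - 1) : ℕ) : ℝ≥0∞)⁻¹ * ∏ i ∈ Finset.range n, transProb (s i) (s (i + 1)) := by
  have := isProbabilityMeasure_walkMeasure hr
  have hne : Nonempty (Nielsen r) := ⟨s 0⟩
  have hset : ∀ m, {ω : ℕ → Nielsen r | ∀ i ≤ m, ω i = s i} =
      Preorder.frestrictLe (π := fun _ => Nielsen r) m ⁻¹'
        {Preorder.frestrictLe (π := fun _ => Nielsen r) m s} := by
    intro m
    ext ω
    simp only [Set.mem_ofPred_eq, Set.mem_preimage, Set.mem_singleton_iff, funext_iff,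
      Preorder.frestrictLe_apply, Subtype.forall, Finset.mem_Iic]
  induction n with
  | zero =>
    have hmap : (walkMeasure r).map (Preorder.frestrictLe (π := fun _ => Nielsen r) 0) =
        (uniformOn (Set.univ : Set (Nielsen r))).map
          (MeasurableEquiv.piUnique (fun i : Finset.Iic 0 => Nielsen r)).symm := by
      rw [walkMeasure, Kernel.trajMeasure, Measure.map_comp _ _ (by fun_prop),
        Kernel.traj_map_frestrictLe, Kernel.partialTraj_self, Measure.id_comp]
    rw [hset 0, ← Measure.map_apply (by fun_prop) (measurableSet_singleton _), hmap,
      Measure.map_apply (by fun_prop) (measurableSet_singleton _)]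
    have hpre : (MeasurableEquiv.piUnique (fun i : Finset.Iic 0 => Nielsen r)).symm ⁻¹'
        {Preorder.frestrictLe (π := fun _ => Nielsen r) 0 s} = {s 0} := by
      ext θ
      rw [Set.mem_preimage, Set.mem_singleton_iff, Set.mem_singleton_iff,
        MeasurableEquiv.symm_apply_eq]
      rfl
    rw [hpre, uniformOn_univ, Measure.count_singleton, Nielsen.card_eq]
    simp
  | succ n ih =>
    have h := Kernel.map_frestrictLe_trajMeasure_compProd_eq_map_trajMeasure
      (X := fun _ => Nielsen r) (μ₀ := uniformOn Set.univ) (κ := transKernel r) (a := n)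
    change (walkMeasure r).map _ ⊗ₘ _ = (walkMeasure r).map _ at h
    have hs : {ω : ℕ → Nielsen r | ∀ i ≤ n + 1, ω i = s i} =
        (fun ω : ℕ → Nielsen r => (Preorder.frestrictLe (π := fun _ => Nielsen r) n ω, ω (n + 1)))
          ⁻¹' ({Preorder.frestrictLe (π := fun _ => Nielsen r) n s} ×ˢ {s (n + 1)}) := by
      ext ω
      have := Set.ext_iff.1 (hset n) ω
      rw [Set.mem_preimage] at this
      rw [Set.mem_preimage, Set.mem_prod, ← this]
      simp only [Set.mem_ofPred_eq, Set.mem_singleton_iff]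
      exact ⟨fun h => ⟨fun i hi => h i (by omega), h _ le_rfl⟩, fun h i hi => by
        rcases Nat.lt_or_ge n i with h' | h'
        · obtain rfl : i = n + 1 := by omega
          exact h.2
        · exact h.1 i h'⟩
    rw [hs, ← Measure.map_apply (by fun_prop)
      ((measurableSet_singleton _).prod (measurableSet_singleton _)), ← h,
      Measure.compProd_apply_prod (measurableSet_singleton _) (measurableSet_singleton _),
      lintegral_singleton, Measure.map_apply (by fun_prop) (measurableSet_singleton _), ← hset n,
      ih, Finset.prod_range_succ]
    have hk : transKernel r n (Preorder.frestrictLe (π := fun _ => Nielsen r) n s) {s (n + 1)} =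
        transProb (s n) (s (n + 1)) := by
      change (nextState (s n)).toMeasure {s (n + 1)} = _
      rw [PMF.toMeasure_apply_singleton _ _ (measurableSet_singleton _)]
      rfl
    rw [hk]
    ring

/-!
Word length along the walk, `f n = |θ_n ⋯ θ_1|_Q`, is a bounded subadditive cocycle over the shift.
The transition matrix is doubly stochastic, so the uniform initial law makes the shift measure
preserving (`measurePreserving_seqShift`); for `r ≥ 3` admissibility is a strongly connected
relation, so the shift is ergodic (`ergodic_seqShift`). Kingman's theorem
(`IsSubadditiveCocycle.ae_tendsto_div`) then gives an almost sure limit `c = lim (1/n) ∫ f n`.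

Positivity of `c` comes from the absence of cancellation. The automorphism `[x ↦ y x]` folds only
the turn `{x, y}`. Its images of letters take the turn `{y⁻¹, x}` and otherwise only turns without
`x`, while an admissible successor folds a turn that contains `x` and is not `{y⁻¹, x}`. Hence,
along an admissible trajectory, the substitutions `x ↦ y x` applied to a power `a ^ m` of a basis
element never produce cancellation (`Nielsen.isChain_legal_substWord`), and the uncancelled image
of `a` realizes the length of its conjugacy class (`length_walkWord_le_conjNorm`). Conjugacy length
is a function on outer classes which grows by at most a factor `K` for each generator in `Q`
(`exists_conjNorm_le_pow_wordLength`). On the other hand, a block of `r` steps that replaces each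
basis element once at least doubles the length of every word. Such an admissible block exists, and
by stationarity it occurs at each multiple of `r` with the same positive probability `p`; so
`∫ f (r n) ≥ n p log 2 / log K` (`exists_pos_mul_le_integral_wordLength`).
-/

/-! ### The subadditive ergodic theorem for bounded cocycles -/

namespace MeasureTheory.MeasurePreserving

variable {Ω : Type*} [MeasurableSpace Ω] {T : Ω → Ω} {μ : Measure Ω}

theorem integral_comp_iterate (hT : MeasurePreserving T μ μ) {g : Ω → ℝ} (hg : Measurable g)
    (m : ℕ) : ∫ ω, g (T^[m] ω) ∂μ = ∫ ω, g ω ∂μ := by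
  have h := hT.iterate m
  rw [← integral_map h.measurable.aemeasurable hg.aestronglyMeasurable, h.map_eq]

theorem integrable_comp_iterate (hT : MeasurePreserving T μ μ) {g : Ω → ℝ} (hg : Integrable g μ)
    (m : ℕ) : Integrable (fun ω => g (T^[m] ω)) μ :=
  (hT.iterate m).integrable_comp_of_integrable hg

end MeasureTheory.MeasurePreserving

/-- A bounded subadditive cocycle over a self-map `T`: measurable functions `f n` with
`0 ≤ f n ≤ C n` and `f (m + n) ≤ f m + f n ∘ T^m`. -/
structure IsSubadditiveCocycle {Ω : Type*} [MeasurableSpace Ω] (T : Ω → Ω) (f : ℕ → Ω → ℝ)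
    (C : ℝ) : Prop where
  measurable : ∀ n, Measurable (f n)
  nonneg : ∀ n ω, 0 ≤ f n ω
  le : ∀ n ω, f n ω ≤ C * n
  add_le : ∀ m n ω, f (m + n) ω ≤ f m ω + f n (T^[m] ω)

namespace IsSubadditiveCocycle

variable {Ω : Type*} [MeasurableSpace Ω] {T : Ω → Ω} {f : ℕ → Ω → ℝ} {C : ℝ}

theorem integrable (hf : IsSubadditiveCocycle T f C) (μ : Measure Ω) [IsFiniteMeasure μ] (n : ℕ) :
    Integrable (f n) μ :=
  Integrable.of_bound (hf.measurable n).aestronglyMeasurable (C * n)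
    (Eventually.of_forall fun ω => by
      rw [Real.norm_of_nonneg (hf.nonneg n ω)]; exact hf.le n ω)

theorem const_nonneg [Nonempty Ω] (hf : IsSubadditiveCocycle T f C) : 0 ≤ C := by
  obtain ⟨ω⟩ := ‹Nonempty Ω›
  simpa using (hf.nonneg 1 ω).trans (hf.le 1 ω)

theorem div_le [Nonempty Ω] (hf : IsSubadditiveCocycle T f C) (n : ℕ) (ω : Ω) :
    f n ω / n ≤ C :=
  div_le_of_le_mul₀ (by positivity) hf.const_nonneg (hf.le n ω)

theorem div_nonneg (hf : IsSubadditiveCocycle T f C) (n : ℕ) (ω : Ω) : 0 ≤ f n ω / n :=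
  _root_.div_nonneg (hf.nonneg n ω) (by positivity)

variable {μ : Measure Ω}

theorem subadditive_integral [IsFiniteMeasure μ] (hf : IsSubadditiveCocycle T f C)
    (hT : MeasurePreserving T μ μ) : Subadditive fun n => ∫ ω, f n ω ∂μ := by
  intro m n
  dsimp only
  rw [← hT.integral_comp_iterate (hf.measurable n) m, ← integral_add (hf.integrable μ m)
    (hT.integrable_comp_iterate (hf.integrable μ n) m)]
  exact integral_mono (hf.integrable μ _)
    ((hf.integrable μ m).add (hT.integrable_comp_iterate (hf.integrable μ n) m))
    fun ω => hf.add_le m n ω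

theorem bddBelow_integral_div (hf : IsSubadditiveCocycle T f C) :
    BddBelow (Set.range fun n : ℕ => (∫ ω, f n ω ∂μ) / n) := by
  refine ⟨0, ?_⟩
  rintro _ ⟨n, rfl⟩
  exact _root_.div_nonneg (integral_nonneg (hf.nonneg n)) (by positivity)

/-- Outside `B` the cocycle has average at most `t` along some initial segment of length at most
`M`. Cutting an orbit greedily into such segments, single steps at visits to `B`, and a final piece
of length less than `M` bounds the cocycle. -/
theorem le_of_forall_notMem (hf : IsSubadditiveCocycle T f C) {t : ℝ} (ht : 0 ≤ t) {M : ℕ}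
    {B : Set Ω} (hB : ∀ ω ∉ B, ∃ k, 1 ≤ k ∧ k ≤ M ∧ f k ω ≤ t * k) (n : ℕ) (ω : Ω) :
    f n ω ≤ t * n + C * ∑ i ∈ Finset.range n, B.indicator 1 (T^[i] ω) + C * M := by
  have : Nonempty Ω := ⟨ω⟩
  have hC := hf.const_nonneg
  have hind : ∀ ω, (0 : ℝ) ≤ B.indicator 1 ω := fun ω => Set.indicator_nonneg (by simp) ω
  induction n using Nat.strong_induction_on generalizing ω with
  | _ n ih =>
  have hsum : 0 ≤ ∑ i ∈ Finset.range n, B.indicator (1 : Ω → ℝ) (T^[i] ω) :=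
    Finset.sum_nonneg fun i _ => hind _
  rcases lt_or_ge n M with hn | hn
  · have h1 : f n ω ≤ C * M := (hf.le n ω).trans (by gcongr)
    have : 0 ≤ t * n + C * ∑ i ∈ Finset.range n, B.indicator (1 : Ω → ℝ) (T^[i] ω) := by positivity
    linarith
  -- a segment of length `k` after which the induction hypothesis applies
  have step : ∀ k, 1 ≤ k → k ≤ n →
      f k ω ≤ t * k + C * ∑ i ∈ Finset.range k, B.indicator 1 (T^[i] ω) →
      f n ω ≤ t * n + C * ∑ i ∈ Finset.range n, B.indicator 1 (T^[i] ω) + C * M := by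
    intro k hk1 hk hfk
    obtain ⟨l, rfl⟩ := Nat.exists_eq_add_of_le hk
    have h1 := hf.add_le k l ω
    have h2 := ih l (by omega) (T^[k] ω)
    rw [Finset.sum_range_add]
    have h3 : ∀ i, T^[i] (T^[k] ω) = T^[k + i] ω := fun i => by
      rw [add_comm, Function.iterate_add_apply]
    simp only [h3] at h2
    push_cast
    linarith
  by_cases hω : ω ∈ B
  · rcases Nat.eq_zero_or_pos n with rfl | hn0
    · have := hf.le 0 ω
      have h4 : 0 ≤ C * M := by positivity
      simp only [Nat.cast_zero, mul_zero] at this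
      simp; linarith
    · refine step 1 le_rfl hn0 ?_
      have := hf.le 1 ω
      simp [hω] at this ⊢
      linarith
  · obtain ⟨k, h1, h2, h3⟩ := hB ω hω
    refine step k h1 (h2.trans hn) ?_
    have : 0 ≤ C * ∑ i ∈ Finset.range k, B.indicator (1 : Ω → ℝ) (T^[i] ω) :=
      mul_nonneg hC (Finset.sum_nonneg fun i _ => hind _)
    linarith

variable [IsProbabilityMeasure μ]

/-- The mean growth rate `lim (1/n) ∫ f n` of a bounded subadditive cocycle. -/
noncomputable def rate (hf : IsSubadditiveCocycle T f C) (hT : MeasurePreserving T μ μ) : ℝ :=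
  (hf.subadditive_integral hT).lim

theorem tendsto_integral_div (hf : IsSubadditiveCocycle T f C) (hT : MeasurePreserving T μ μ) :
    Tendsto (fun n : ℕ => (∫ ω, f n ω ∂μ) / n) atTop (𝓝 (hf.rate hT)) :=
  (hf.subadditive_integral hT).tendsto_lim hf.bddBelow_integral_div

theorem rate_le_of_forall_exists (hf : IsSubadditiveCocycle T f C) (hT : MeasurePreserving T μ μ)
    {t : ℝ} (h : ∀ᵐ ω ∂μ, ∃ n, 1 ≤ n ∧ f n ω ≤ t * n) : hf.rate hT ≤ t := by
  obtain ⟨ω₀, n₀, hn₀, h₀⟩ := h.exists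
  have : Nonempty Ω := ⟨ω₀⟩
  have hC := hf.const_nonneg
  have ht : 0 ≤ t := by
    have h1 : 0 ≤ t * n₀ := (hf.nonneg n₀ ω₀).trans h₀
    have h2 : (0 : ℝ) < n₀ := by exact_mod_cast hn₀
    exact nonneg_of_mul_nonneg_left h1 h2
  let B : ℕ → Set Ω := fun M => {ω | ∀ k, 1 ≤ k → k ≤ M → t * k < f k ω}
  have hBm : ∀ M, MeasurableSet (B M) := by
    intro M
    have : B M = ⋂ k, ⋂ (_ : 1 ≤ k), ⋂ (_ : k ≤ M), {ω | t * k < f k ω} := by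
      ext ω; simp [B]
    rw [this]
    exact MeasurableSet.iInter fun k => MeasurableSet.iInter fun _ => MeasurableSet.iInter fun _ =>
      measurableSet_lt measurable_const (hf.measurable k)
  have hBanti : Antitone B := fun M N hMN ω hω k h1 h2 => hω k h1 (h2.trans hMN)
  have hBlim : Tendsto (fun M => μ.real (B M)) atTop (𝓝 0) := by
    have h1 := tendsto_measure_iInter_atTop (μ := μ) (fun M => (hBm M).nullMeasurableSet) hBanti
      ⟨0, measure_ne_top _ _⟩
    have h2 : μ (⋂ M, B M) = 0 := by
      refine measure_mono_null ?_ (ae_iff.1 h)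
      intro ω hω
      simp only [Set.mem_iInter] at hω
      rintro ⟨n, hn, h3⟩
      exact absurd h3 (not_le.2 (hω n n hn le_rfl))
    rw [h2] at h1
    exact (ENNReal.tendsto_toReal ENNReal.zero_ne_top).comp h1
  have key : ∀ M, hf.rate hT ≤ t + C * μ.real (B M) := by
    intro M
    have hB : ∀ ω ∉ B M, ∃ k, 1 ≤ k ∧ k ≤ M ∧ f k ω ≤ t * k := by
      intro ω hω
      simp only [B, Set.mem_ofPred_eq] at hω
      push Not at hω
      exact hω
    have hmi : Measurable ((B M).indicator (1 : Ω → ℝ)) := measurable_one.indicator (hBm M)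
    have hii : Integrable ((B M).indicator (1 : Ω → ℝ)) μ :=
      (integrable_const (1 : ℝ)).indicator (hBm M)
    have hint : ∀ n : ℕ, ∫ ω, f n ω ∂μ ≤ t * n + C * (n * μ.real (B M)) + C * M := by
      intro n
      have hi : ∀ i ∈ Finset.range n,
          Integrable (fun ω => (B M).indicator (1 : Ω → ℝ) (T^[i] ω)) μ :=
        fun i _ => hT.integrable_comp_iterate hii i
      have hs := (integrable_finsetSum _ hi).const_mul C
      have h1 : ∫ ω, ((t * n + C * M) + C * ∑ i ∈ Finset.range n,
          (B M).indicator (1 : Ω → ℝ) (T^[i] ω)) ∂μ = t * n + C * (n * μ.real (B M)) + C * M := by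
        rw [integral_add (integrable_const _) hs, integral_const_mul, integral_finsetSum _ hi]
        simp only [hT.integral_comp_iterate hmi, integral_indicator_one (hBm M)]
        simp
        ring
      rw [← h1]
      refine integral_mono (hf.integrable μ n) ((integrable_const _).add hs) fun ω => ?_
      have := hf.le_of_forall_notMem ht hB n ω
      dsimp only
      linarith
    refine le_of_tendsto_of_tendsto (hf.tendsto_integral_div hT)
      (b := atTop) (g := fun n : ℕ => t + C * μ.real (B M) + C * M / n) ?_ ?_
    · simpa using tendsto_const_nhds.add (tendsto_const_div_atTop_nhds_zero_nat (C * M))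
    · filter_upwards [eventually_gt_atTop 0] with n hn
      have hn' : (0 : ℝ) < n := by exact_mod_cast hn
      rw [div_le_iff₀ hn']
      refine (hint n).trans (le_of_eq ?_)
      field_simp
  have := ge_of_tendsto' (tendsto_const_nhds.add (hBlim.const_mul C)) key
  simpa using this

/-- The lower half of the subadditive ergodic theorem. -/
theorem ae_eventually_lt_div (hf : IsSubadditiveCocycle T f C) (hT : Ergodic T μ)
    {t : ℝ} (ht : t < hf.rate hT.toMeasurePreserving) :
    ∀ᵐ ω ∂μ, ∀ᶠ n : ℕ in atTop, t < f n ω / n := by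
  have : Nonempty Ω := μ.nonempty_of_neZero
  have hC := hf.const_nonneg
  let F : Ω → ℝ := fun ω => liminf (fun n : ℕ => f n ω / n) atTop
  have hFm : Measurable F := Measurable.liminf fun n => (hf.measurable n).div_const _
  have hbdd : ∀ ω, IsBoundedUnder (· ≥ ·) atTop (fun n : ℕ => f n ω / n) := fun ω =>
    isBoundedUnder_of ⟨0, fun n => hf.div_nonneg n ω⟩
  have hcobdd : ∀ ω, IsCoboundedUnder (· ≥ ·) atTop (fun n : ℕ => f n ω / n) := fun ω =>
    (isBoundedUnder_of (r := (· ≤ ·)) ⟨C, fun n => hf.div_le n ω⟩).isCoboundedUnder_ge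
  have hFT : ∀ ω, F ω ≤ F (T ω) := by
    intro ω
    refine le_of_forall_gt fun s hs => ?_
    obtain ⟨s', hs', hs''⟩ := exists_between hs
    have h1 : ∃ᶠ n : ℕ in atTop, f n (T ω) / n < s' :=
      frequently_lt_of_liminf_lt (hcobdd _) hs'
    have h2 : ∀ᶠ n : ℕ in atTop, C / n < (s - s') / 2 :=
      (tendsto_const_div_atTop_nhds_zero_nat C).eventually_lt_const (by linarith)
    have h3 : ∃ᶠ n : ℕ in atTop, f (n + 1) ω / (n + 1 : ℕ) ≤ (s + s') / 2 := by
      refine (h1.and_eventually (h2.and (eventually_gt_atTop 0))).mono ?_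
      rintro n ⟨h4, h5, h6⟩
      have hn : (0 : ℝ) < n := by exact_mod_cast h6
      have h7 := hf.add_le 1 n ω
      have h8 := hf.le 1 ω
      rw [add_comm 1 n] at h7
      simp only [Function.iterate_one, Nat.cast_one, mul_one] at h7 h8
      calc f (n + 1) ω / (n + 1 : ℕ) ≤ f (n + 1) ω / n := by
            have := hf.nonneg (n + 1) ω
            gcongr
            simp
        _ ≤ (C + f n (T ω)) / n := by gcongr; linarith
        _ = C / n + f n (T ω) / n := add_div _ _ _
        _ ≤ (s + s') / 2 := by linarith
    have h9 : ∃ᶠ n : ℕ in atTop, f n ω / n ≤ (s + s') / 2 := by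
      rw [frequently_atTop] at h3 ⊢
      intro a
      obtain ⟨b, hb, h⟩ := h3 a
      exact ⟨b + 1, by omega, h⟩
    have : F ω ≤ (s + s') / 2 := liminf_le_of_frequently_le h9 (hbdd ω)
    linarith
  obtain ⟨t', ht1, ht2⟩ := exists_between ht
  have hA : MeasurableSet {ω | F ω ≤ t} := measurableSet_le hFm measurable_const
  rcases hT.ae_empty_or_univ_of_preimage_ae_le hA.nullMeasurableSet
      (Eventually.of_forall fun ω (h : F (T ω) ≤ t) => (hFT ω).trans h) with h | h
  · have h' : ∀ᵐ ω ∂μ, ω ∉ {ω | F ω ≤ t} := by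
      filter_upwards [h] with ω hω h1
      exact (hω.mp h1 :)
    filter_upwards [h'] with ω hω
    exact eventually_lt_of_lt_liminf (not_le.1 hω) (hbdd ω)
  · exfalso
    refine absurd (hf.rate_le_of_forall_exists hT.toMeasurePreserving (t := t') ?_) (not_le.2 ht2)
    have h' : ∀ᵐ ω ∂μ, ω ∈ {ω | F ω ≤ t} := by
      filter_upwards [h] with ω hω
      exact (hω.mpr trivial :)
    filter_upwards [h'] with ω hω
    have h1 : ∃ᶠ n : ℕ in atTop, f n ω / n < t' :=
      frequently_lt_of_liminf_lt (hcobdd _) (lt_of_le_of_lt hω ht1)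
    obtain ⟨n, h2, h3⟩ := (h1.and_eventually (eventually_ge_atTop 1)).exists
    have hn : (0 : ℝ) < n := by exact_mod_cast h3
    exact ⟨n, h3, ((div_lt_iff₀ hn).1 h2).le⟩

end IsSubadditiveCocycle

/-- The upper half of Birkhoff's theorem for a bounded observable `g`: apply the lower half of the
subadditive theorem to the Birkhoff sums of `C - g`. -/
theorem Ergodic.ae_eventually_birkhoffSum_div_lt {Ω : Type*} [MeasurableSpace Ω] {T : Ω → Ω}
    {μ : Measure Ω} [IsProbabilityMeasure μ] (hT : Ergodic T μ) {g : Ω → ℝ} {C : ℝ}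
    (hg : Measurable g) (h0 : ∀ ω, 0 ≤ g ω) (hC : ∀ ω, g ω ≤ C) {t : ℝ} (ht : ∫ ω, g ω ∂μ < t) :
    ∀ᵐ ω ∂μ, ∀ᶠ n : ℕ in atTop, birkhoffSum T g n ω / n < t := by
  have hgi : Integrable g μ := Integrable.of_bound hg.aestronglyMeasurable C
    (Eventually.of_forall fun ω => by rw [Real.norm_of_nonneg (h0 ω)]; exact hC ω)
  have hcm : Measurable fun ω => C - g ω := measurable_const.sub hg
  have hf : IsSubadditiveCocycle T (birkhoffSum T fun ω => C - g ω) C :=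
    { measurable := fun n => by
        unfold birkhoffSum
        exact Finset.measurable_fun_sum _ fun i _ => hcm.comp (hT.measurable.iterate i)
      nonneg := fun n ω => Finset.sum_nonneg fun i _ => sub_nonneg.2 (hC _)
      le := fun n ω => by
        refine (Finset.sum_le_card_nsmul _ _ C fun i _ => ?_).trans (le_of_eq ?_)
        · have := h0 (T^[i] ω); linarith
        · simp [mul_comm]
      add_le := fun m n ω => (birkhoffSum_add _ _ _ _ _).le }
  have hrate : hf.rate hT.toMeasurePreserving = C - ∫ ω, g ω ∂μ := by
    refine tendsto_nhds_unique (hf.tendsto_integral_div hT.toMeasurePreserving)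
      (tendsto_const_nhds.congr' ?_)
    filter_upwards [eventually_gt_atTop 0] with n hn
    have hn' : (n : ℝ) ≠ 0 := by exact_mod_cast hn.ne'
    simp only [birkhoffSum]
    rw [integral_finsetSum _ fun i _ => hT.toMeasurePreserving.integrable_comp_iterate
      (g := fun ω => C - g ω) ((integrable_const C).sub hgi) i]
    simp only [hT.toMeasurePreserving.integral_comp_iterate hcm]
    rw [integral_sub (integrable_const C) hgi]
    simp
    field_simp
  have := hf.ae_eventually_lt_div hT (t := C - t) (by rw [hrate]; linarith)
  filter_upwards [this] with ω hω
  filter_upwards [hω, eventually_gt_atTop 0] with n hn hn0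
  have hn' : (n : ℝ) ≠ 0 := by exact_mod_cast hn0.ne'
  have h1 : birkhoffSum T (fun ω => C - g ω) n ω = n * C - birkhoffSum T g n ω := by
    simp [birkhoffSum]
  rw [h1, sub_div, mul_div_cancel_left₀ _ hn'] at hn
  linarith

namespace IsSubadditiveCocycle

variable {Ω : Type*} [MeasurableSpace Ω] {T : Ω → Ω} {f : ℕ → Ω → ℝ} {C : ℝ}
  {μ : Measure Ω} [IsProbabilityMeasure μ]

/-- Averaging the subadditivity inequality over the residues modulo `m` compares the cocycle with
the Birkhoff sums of `f m` over `T` itself (rather than over `T^m`, which need not be ergodic). -/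
theorem mul_le_birkhoffSum (hf : IsSubadditiveCocycle T f C) (m n : ℕ) (ω : Ω) :
    m * f (n + m) ω ≤ birkhoffSum T (f m) n ω + 2 * C * m ^ 2 := by
  have : Nonempty Ω := ⟨ω⟩
  have hC := hf.const_nonneg
  have h1 : ∀ n, ∑ j ∈ Finset.range m, f (n + j) ω ≤ birkhoffSum T (f m) n ω + C * m ^ 2 := by
    intro n
    induction n with
    | zero =>
      simp only [zero_add, birkhoffSum_zero]
      refine (Finset.sum_le_card_nsmul _ _ (C * m) fun j hj => ?_).trans (le_of_eq ?_)
      · have : (j : ℝ) ≤ m := by exact_mod_cast (Finset.mem_range.1 hj).le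
        exact (hf.le j ω).trans (by gcongr)
      · rw [Finset.card_range, nsmul_eq_mul]; ring
    | succ n ih =>
      have h2 := Finset.sum_range_succ (fun j => f (n + j) ω) m
      have h3 := Finset.sum_range_succ' (fun j => f (n + j) ω) m
      have h4 : ∑ j ∈ Finset.range m, f (n + 1 + j) ω = ∑ j ∈ Finset.range m, f (n + (j + 1)) ω :=
        Finset.sum_congr rfl fun j _ => by rw [add_right_comm, add_assoc]
      simp only [add_zero] at h3
      have h5 := hf.add_le n m ω
      rw [birkhoffSum_succ]
      linarith
  have h6 : ∀ j ∈ Finset.range m, f (n + m) ω ≤ f (n + j) ω + C * m := by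
    intro j hj
    have hj' := (Finset.mem_range.1 hj).le
    have h7 := hf.add_le (n + j) (m - j) ω
    rw [show n + j + (m - j) = n + m by omega] at h7
    have h8 : f (m - j) (T^[n + j] ω) ≤ C * m := (hf.le _ _).trans (by gcongr; omega)
    linarith
  have h9 := Finset.sum_le_sum h6
  rw [Finset.sum_add_distrib] at h9
  simp only [Finset.sum_const, Finset.card_range, nsmul_eq_mul] at h9
  have := h1 n
  linarith

theorem ae_eventually_div_lt (hf : IsSubadditiveCocycle T f C) (hT : Ergodic T μ)
    {t : ℝ} (ht : hf.rate hT.toMeasurePreserving < t) :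
    ∀ᵐ ω ∂μ, ∀ᶠ n : ℕ in atTop, f n ω / n < t := by
  have : Nonempty Ω := μ.nonempty_of_neZero
  have hC := hf.const_nonneg
  obtain ⟨m, hm, hm0⟩ := (((hf.tendsto_integral_div hT.toMeasurePreserving).eventually_lt_const
    ht).and (eventually_gt_atTop 0)).exists
  have hm' : (0 : ℝ) < m := by exact_mod_cast hm0
  obtain ⟨t', ht1, ht2⟩ := exists_between hm
  rw [div_lt_iff₀ hm'] at ht1
  filter_upwards [hT.ae_eventually_birkhoffSum_div_lt (hf.measurable m) (hf.nonneg m) (hf.le m) ht1]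
    with ω hω
  have h2 : ∀ᶠ n : ℕ in atTop, 2 * C * m / n < t - t' :=
    (tendsto_const_div_atTop_nhds_zero_nat _).eventually_lt_const (by linarith)
  have h3 : ∀ᶠ n : ℕ in atTop, f (n + m) ω / (n + m : ℕ) < t := by
    filter_upwards [hω, h2, eventually_gt_atTop 0] with n h3 h4 h5
    have hn : (0 : ℝ) < n := by exact_mod_cast h5
    have h6 := hf.mul_le_birkhoffSum m n ω
    rw [div_lt_iff₀ hn] at h3 h4
    calc f (n + m) ω / (n + m : ℕ) ≤ f (n + m) ω / n := by
            have := hf.nonneg (n + m) ω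
            gcongr
            simp
      _ < t := by
        rw [div_lt_iff₀ hn]
        refine lt_of_mul_lt_mul_left ?_ hm'.le
        nlinarith
  obtain ⟨a, ha⟩ := eventually_atTop.1 h3
  refine eventually_atTop.2 ⟨a + m, fun n hn => ?_⟩
  have := ha (n - m) (by omega)
  rwa [Nat.sub_add_cancel (by omega)] at this

/-- **Kingman's subadditive ergodic theorem** for bounded cocycles over an ergodic map. -/
theorem ae_tendsto_div (hf : IsSubadditiveCocycle T f C) (hT : Ergodic T μ) :
    ∀ᵐ ω ∂μ, Tendsto (fun n : ℕ => f n ω / n) atTop (𝓝 (hf.rate hT.toMeasurePreserving)) := by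
  set l := hf.rate hT.toMeasurePreserving
  obtain ⟨u, -, hu1, hu⟩ := exists_seq_strictMono_tendsto l
  obtain ⟨v, -, hv1, hv⟩ := exists_seq_strictAnti_tendsto l
  have h1 : ∀ᵐ ω ∂μ, ∀ k, ∀ᶠ n : ℕ in atTop, u k < f n ω / n :=
    ae_all_iff.2 fun k => hf.ae_eventually_lt_div hT (hu1 k)
  have h2 : ∀ᵐ ω ∂μ, ∀ k, ∀ᶠ n : ℕ in atTop, f n ω / n < v k :=
    ae_all_iff.2 fun k => hf.ae_eventually_div_lt hT (hv1 k)
  filter_upwards [h1, h2] with ω h3 h4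
  refine tendsto_order.2 ⟨fun a ha => ?_, fun a ha => ?_⟩
  · obtain ⟨k, hk⟩ := (hu.eventually_const_lt ha).exists
    exact (h3 k).mono fun n hn => hk.trans hn
  · obtain ⟨k, hk⟩ := (hv.eventually_lt_const ha).exists
    exact (h4 k).mono fun n hn => hn.trans hk

end IsSubadditiveCocycle

/-! ### Measures on sequence spaces and the shift -/

/-- Finite measures on one-sided sequences in a countable alphabet are determined by the masses of
the cylinders that prescribe an initial segment. -/
theorem measure_ext_of_cylinder {S : Type*} [Countable S] [MeasurableSpace S]
    [MeasurableSingletonClass S] {μ ν : Measure (ℕ → S)} [IsFiniteMeasure μ]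
    (h : ∀ n (s : ℕ → S), μ {ω | ∀ i ≤ n, ω i = s i} = ν {ω | ∀ i ≤ n, ω i = s i}) : μ = ν := by
  have hproj : IsProjectiveMeasureFamily (α := fun _ : ℕ => S) fun I : Finset ℕ =>
      μ.map (I.restrict (π := fun _ => S)) := by
    intro I J hJI
    rw [Measure.map_map (by fun_prop) (by fun_prop)]
    rfl
  refine IsProjectiveLimit.unique (α := fun _ : ℕ => S) (P := fun I : Finset ℕ => μ.map (I.restrict (π := fun _ => S)))
    (fun I => rfl) ((isProjectiveLimit_nat_iff hproj ν).2 fun n => ?_)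
  refine Measure.ext_of_singleton fun x => ?_
  let s : ℕ → S := fun i => x ⟨min i n, Finset.mem_Iic.2 (min_le_right _ _)⟩
  have hpre : Preorder.frestrictLe (π := fun _ => S) n ⁻¹' {x} = {ω | ∀ i ≤ n, ω i = s i} := by
    ext ω
    simp only [Set.mem_preimage, Set.mem_singleton_iff, funext_iff, Preorder.frestrictLe_apply,
      Subtype.forall, Finset.mem_Iic, Set.mem_ofPred_eq, s]
    refine forall₂_congr fun i hi => ?_
    simp only [min_eq_left hi]
  have h1 := Measure.map_apply (μ := ν) (Preorder.measurable_frestrictLe (X := fun _ => S) n)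
    (measurableSet_singleton x)
  have h2 := Measure.map_apply (μ := μ) (Preorder.measurable_frestrictLe (X := fun _ => S) n)
    (measurableSet_singleton x)
  rw [hpre] at h1 h2
  exact h1.trans ((h n s).symm.trans h2.symm)

/-- The one-sided shift. -/
def seqShift {S : Type*} (ω : ℕ → S) : ℕ → S := fun i => ω (i + 1)

theorem seqShift_iterate {S : Type*} (n : ℕ) (ω : ℕ → S) (i : ℕ) :
    seqShift^[n] ω i = ω (i + n) := by
  induction n generalizing ω with
  | zero => rfl
  | succ n ih =>
    rw [Function.iterate_succ_apply, ih]
    simp only [seqShift]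
    congr 1

theorem measurable_seqShift {S : Type*} [MeasurableSpace S] :
    Measurable (seqShift : (ℕ → S) → ℕ → S) :=
  measurable_pi_lambda _ fun i => measurable_pi_apply (i + 1)

theorem measurableSet_cylinder {S : Type*} [MeasurableSpace S] [MeasurableSingletonClass S]
    (n : ℕ) (s : ℕ → S) : MeasurableSet {ω : ℕ → S | ∀ i ≤ n, ω i = s i} := by
  have : {ω : ℕ → S | ∀ i ≤ n, ω i = s i} = ⋂ i, ⋂ (_ : i ≤ n), {ω | ω i = s i} := by
    ext ω; simp
  rw [this]
  exact MeasurableSet.iInter fun i => MeasurableSet.iInter fun _ =>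
    (measurable_pi_apply i : Measurable fun ω : ℕ → S => ω i) (measurableSet_singleton (s i))

/-! ### Strong connectivity and ergodicity of the Markov chain -/

/-- A function harmonic for a stochastic kernel on a finite set is constant if the positive
transitions connect any two states: the set where it is maximal is closed under transitions. -/
theorem eq_of_harmonic {S : Type*} [Fintype S] {P : S → S → ℝ} (hP : ∀ s t, 0 ≤ P s t)
    (hrow : ∀ s, ∑ t, P s t = 1)
    (hirr : ∀ s t, Relation.ReflTransGen (fun a b => 0 < P a b) s t)
    {h : S → ℝ} (hh : ∀ s, h s = ∑ t, P s t * h t) (s t : S) : h s = h t := by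
  have : Nonempty S := ⟨s⟩
  obtain ⟨m, hm⟩ := Finite.exists_max h
  have step : ∀ a b, h a = h m → 0 < P a b → h b = h m := by
    intro a b ha hab
    have h1 : ∑ t, P a t * (h m - h t) = 0 := by
      simp only [mul_sub, Finset.sum_sub_distrib, ← hh a, ha, ← Finset.sum_mul, hrow]
      ring
    have h2 := (Finset.sum_eq_zero_iff_of_nonneg fun t _ =>
      mul_nonneg (hP a t) (sub_nonneg.2 (hm t))).1 h1 b (Finset.mem_univ b)
    rcases mul_eq_zero.1 h2 with h3 | h3
    · exact absurd h3 hab.ne'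
    · linarith
  have all : ∀ b, h b = h m := by
    intro b
    have := hirr m b
    induction this with
    | refl => rfl
    | tail _ hbc ih => exact step _ _ ih hbc
  rw [all s, all t]

namespace Nielsen

variable {r : ℕ}

/-- The Nielsen automorphism with given letters. -/
def ofLetters (x y : Letter r) (h : y.1 ≠ x.1) : Nielsen r :=
  ⟨(x, y), (Letter.fst_ne_iff x y).1 h⟩

theorem exists_index_ne (hr : 3 ≤ r) (i j : Fin r) : ∃ k : Fin r, k ≠ i ∧ k ≠ j := by
  have : ∃ k, k ∉ ({i, j} : Finset (Fin r)) := by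
    by_contra! h
    have h1 := Finset.card_le_card (fun k _ => h k : (Finset.univ : Finset (Fin r)) ⊆ {i, j})
    have h2 : ({i, j} : Finset (Fin r)).card ≤ 2 := Finset.card_le_two
    simp at h1
    omega
  obtain ⟨k, hk⟩ := this
  exact ⟨k, by simpa using hk⟩

theorem reachable_same_x (hr : 3 ≤ r) (x y z : Letter r) (hy : y.1 ≠ x.1) (hz : z.1 ≠ x.1) :
    Relation.ReflTransGen Admissible (ofLetters x y hy) (ofLetters x z hz) := by
  by_cases h : z = y.inv
  · obtain ⟨k, hk1, hk2⟩ := exists_index_ne hr x.1 y.1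
    have h1 : Admissible (ofLetters x y hy) (ofLetters x (k, true) hk1) :=
      Or.inl ⟨rfl, fun e => hk2 (congrArg Prod.fst e)⟩
    have h2 : Admissible (ofLetters x (k, true) hk1) (ofLetters x z hz) :=
      Or.inl ⟨rfl, fun e => hk2 (by
        have e1 : z.1 = k := congrArg Prod.fst e
        rw [← e1, h]; rfl)⟩
    exact (Relation.ReflTransGen.single h1).tail h2
  · exact Relation.ReflTransGen.single (Or.inl ⟨rfl, h⟩)

theorem reachable_of_index_ne (hr : 3 ≤ r) (x y z w : Letter r) (hy : y.1 ≠ x.1)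
    (hzx : z.1 ≠ x.1) (hw : w.1 ≠ z.1) :
    Relation.ReflTransGen Admissible (ofLetters x y hy) (ofLetters z w hw) := by
  have h1 : Admissible (ofLetters x z hzx) (ofLetters z x hzx.symm) :=
    Or.inr ⟨rfl, fun e => by
      have e1 : z.2 = !z.2 := congrArg Prod.snd e
      cases h : z.2 <;> simp [h] at e1⟩
  exact ((reachable_same_x hr x y z hy hzx).tail h1).trans (reachable_same_x hr z x w _ hw)

/-- The admissibility digraph is strongly connected. -/
theorem reachable (hr : 3 ≤ r) (θ θ' : Nielsen r) : Relation.ReflTransGen Admissible θ θ' := by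
  by_cases h : θ'.x.1 = θ.x.1
  · have h1 := reachable_of_index_ne hr θ.x θ.y θ.y θ.x θ.y_fst_ne θ.y_fst_ne θ.y_fst_ne.symm
    have h2 := reachable_of_index_ne hr θ.y θ.x θ'.x θ'.y θ.y_fst_ne.symm
      (by rw [h]; exact θ.y_fst_ne.symm) θ'.y_fst_ne
    exact h1.trans h2
  · exact reachable_of_index_ne hr θ.x θ.y θ'.x θ'.y θ.y_fst_ne h θ'.y_fst_ne

/-- Every state has exactly `4r-6` admissible predecessors. -/
theorem card_admissible_pred (θ : Nielsen r) :
    (Finset.univ.filter fun θ' => Admissible θ' θ).card = 4 * r - 6 := by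
  obtain ⟨⟨x, y⟩, h1, h2⟩ := θ
  have h1 : y ≠ x := h1
  have h2 : y ≠ x.inv := h2
  have inv_inv : ∀ z : Letter r, z.inv.inv = z := fun z => by simp [Letter.inv]
  have hself : ∀ z : Letter r, z ≠ z.inv := by
    rintro ⟨i, b⟩
    cases b <;> simp [Letter.inv]
  have hcard : ∀ a b : Letter r, b ≠ a → b ≠ a.inv →
      (Finset.univ \ {a, a.inv, b.inv} : Finset (Letter r)).card = 2 * r - 3 := by
    intro a b hb hb'
    have hab : a ≠ b.inv := fun e => hb' (by rw [e, inv_inv])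
    have hab' : a.inv ≠ b.inv := fun e => hb (by rw [← inv_inv a, e, inv_inv])
    rw [Finset.card_sdiff_of_subset (Finset.subset_univ _), Finset.card_univ, Fintype.card_prod,
      Fintype.card_fin, Fintype.card_bool,
      Finset.card_eq_three.2 ⟨a, a.inv, b.inv, hself a, hab, hab', rfl⟩]
    omega
  have hu : ((Finset.univ.filter fun θ' => Admissible θ' ⟨(x, y), h1, h2⟩).map
      (Function.Embedding.subtype _)) =
      (Finset.univ \ {x, x.inv, y.inv} : Finset (Letter r)).image (fun z => (x, z)) ∪
      (Finset.univ \ {y, y.inv, x.inv} : Finset (Letter r)).image (fun z => (y, z)) := by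
    ext ⟨a, b⟩
    simp only [Finset.mem_map, Finset.mem_filter, Finset.mem_univ, true_and,
      Function.Embedding.coe_subtype, Finset.mem_union, Finset.mem_image, Prod.mk.injEq,
      Finset.mem_sdiff, Finset.mem_insert, Finset.mem_singleton, not_or]
    constructor
    · rintro ⟨⟨⟨a', b'⟩, k1, k2⟩, k3, k4⟩
      simp only [Prod.mk.injEq] at k4
      obtain ⟨rfl, rfl⟩ := k4
      simp only [Admissible, Nielsen.x, Nielsen.y] at k3
      rcases k3 with ⟨rfl, k⟩ | ⟨rfl, k⟩
      · exact Or.inl ⟨b', ⟨k1, k2, fun e => k (by rw [e, inv_inv])⟩, rfl, rfl⟩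
      · exact Or.inr ⟨b', ⟨k1, k2, fun e => k (by rw [e, inv_inv])⟩, rfl, rfl⟩
    · rintro (⟨z, ⟨k1, k2, k3⟩, rfl, rfl⟩ | ⟨z, ⟨k1, k2, k3⟩, rfl, rfl⟩)
      · exact ⟨⟨(x, z), k1, k2⟩, Or.inl ⟨rfl, fun e => k3 (by
          rw [show y = z.inv from e, inv_inv])⟩, rfl⟩
      · exact ⟨⟨(y, z), k1, k2⟩, Or.inr ⟨rfl, fun e => k3 (by
          rw [show x = z.inv from e, inv_inv])⟩, rfl⟩
  have hd : Disjoint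
      ((Finset.univ \ {x, x.inv, y.inv} : Finset (Letter r)).image (fun z => (x, z)))
      ((Finset.univ \ {y, y.inv, x.inv} : Finset (Letter r)).image (fun z => (y, z))) := by
    rw [Finset.disjoint_left]
    rintro ⟨a, b⟩ ha hb
    simp only [Finset.mem_image, Prod.mk.injEq] at ha hb
    obtain ⟨z, -, rfl, -⟩ := ha
    obtain ⟨w, -, e, -⟩ := hb
    exact h1 e
  rw [← Finset.card_map (Function.Embedding.subtype _), hu, Finset.card_union_of_disjoint hd,
    Finset.card_image_of_injective _ (fun a b h => (Prod.mk.inj h).2),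
    Finset.card_image_of_injective _ (fun a b h => (Prod.mk.inj h).2), hcard x y h1 h2,
    hcard y x h1.symm fun e => h2 (by rw [e, inv_inv])]
  omega

end Nielsen

section Walk

variable {r : ℕ}

theorem sum_transProb_left (θ : Nielsen r) : ∑ θ', transProb θ' θ = 1 := by
  have h2 := two_le_of_nielsen θ
  simp only [transProb]
  rw [← Finset.sum_filter, Finset.sum_const, Nielsen.card_admissible_pred, nsmul_eq_mul]
  exact ENNReal.mul_inv_cancel (Nat.cast_ne_zero.2 (by omega)) (ENNReal.natCast_ne_top _)

theorem transProb_ne_top (θ θ' : Nielsen r) : transProb θ θ' ≠ ⊤ := by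
  have h2 := two_le_of_nielsen θ
  unfold transProb
  split_ifs
  · exact ENNReal.inv_ne_top.2 (Nat.cast_ne_zero.2 (by omega))
  · simp

theorem transProb_pos {θ θ' : Nielsen r} (h : Nielsen.Admissible θ θ') : 0 < transProb θ θ' := by
  unfold transProb
  rw [if_pos h]
  exact ENNReal.inv_pos.2 (ENNReal.natCast_ne_top _)

theorem walkMeasure_single (hr : 2 ≤ r) (θ : Nielsen r) :
    walkMeasure r {ω | ω 0 = θ} = ((4 * r * (r - 1) : ℕ) : ℝ≥0∞)⁻¹ := by
  simpa using walkMeasure_cylinder hr (fun _ => θ) 0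

theorem measurableSet_first (θ : Nielsen r) : MeasurableSet {ω : ℕ → Nielsen r | ω 0 = θ} :=
  (measurable_pi_apply 0 : Measurable fun ω : ℕ → Nielsen r => ω 0) (measurableSet_singleton θ)

/-- The uniform distribution is stationary because the transition matrix is doubly stochastic. -/
theorem measurePreserving_seqShift (hr : 2 ≤ r) :
    MeasurePreserving seqShift (walkMeasure r) (walkMeasure r) := by
  have := isProbabilityMeasure_walkMeasure hr
  refine ⟨measurable_seqShift, ?_⟩
  have := Measure.isProbabilityMeasure_map (μ := walkMeasure r)
    (measurable_seqShift (S := Nielsen r)).aemeasurable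
  refine measure_ext_of_cylinder fun n s => ?_
  rw [Measure.map_apply measurable_seqShift (measurableSet_cylinder n s)]
  have hcover : seqShift ⁻¹' {ω | ∀ i ≤ n, ω i = s i} =
      ⋃ a : Nielsen r, {ω : ℕ → Nielsen r | ∀ i ≤ n + 1, ω i = Nat.casesOn i a s} := by
    ext ω
    simp only [Set.mem_preimage, Set.mem_ofPred_eq, Set.mem_iUnion, seqShift]
    constructor
    · intro h
      refine ⟨ω 0, fun i hi => ?_⟩
      cases i with
      | zero => rfl
      | succ i => exact h i (by omega)
    · rintro ⟨a, h⟩ i hi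
      exact h (i + 1) (by omega)
  rw [hcover, measure_iUnion _ fun a => measurableSet_cylinder (n + 1) _, tsum_fintype]
  · have h1 : ∀ a : Nielsen r, walkMeasure r {ω | ∀ i ≤ n + 1, ω i = Nat.casesOn i a s} =
        transProb a (s 0) * walkMeasure r {ω | ∀ i ≤ n, ω i = s i} := by
      intro a
      rw [walkMeasure_cylinder hr (fun i => Nat.casesOn i a s), walkMeasure_cylinder hr s,
        Finset.prod_range_succ']
      change _ * (_ * transProb a (s 0)) = _
      ring
    simp only [h1]
    rw [← Finset.sum_mul, sum_transProb_left, one_mul]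
  · intro a b hab
    refine Set.disjoint_left.2 fun ω ha hb => hab ?_
    exact (ha 0 (by omega)).symm.trans (hb 0 (by omega))

/-- The Markov property at time `n`. The factor `(4r(r-1))⁻¹` is the probability of the state `s n`
at time `0`. -/
theorem walkMeasure_markov (hr : 2 ≤ r) (s : ℕ → Nielsen r) (n : ℕ) {B : Set (ℕ → Nielsen r)}
    (hB : MeasurableSet B) :
    ((4 * r * (r - 1) : ℕ) : ℝ≥0∞)⁻¹ *
      walkMeasure r ({ω | ∀ i ≤ n, ω i = s i} ∩ seqShift^[n] ⁻¹' B) =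
    walkMeasure r {ω | ∀ i ≤ n, ω i = s i} * walkMeasure r ({ω | ω 0 = s n} ∩ B) := by
  have := isProbabilityMeasure_walkMeasure hr
  set μ := walkMeasure r
  set c : ℝ≥0∞ := ((4 * r * (r - 1) : ℕ) : ℝ≥0∞)⁻¹ with hc
  have hc_top : c ≠ ⊤ := by
    refine ENNReal.inv_ne_top.2 (Nat.cast_ne_zero.2 ?_)
    have : 0 < r - 1 := by omega
    positivity
  have hTm : Measurable (seqShift^[n] : (ℕ → Nielsen r) → _) := measurable_seqShift.iterate n
  have key : c • (μ.restrict {ω | ∀ i ≤ n, ω i = s i}).map seqShift^[n] =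
      μ {ω | ∀ i ≤ n, ω i = s i} • μ.restrict {ω | ω 0 = s n} := by
    have : IsFiniteMeasure (c • (μ.restrict {ω | ∀ i ≤ n, ω i = s i}).map seqShift^[n]) :=
      Measure.smul_finite _ hc_top
    refine measure_ext_of_cylinder fun m t => ?_
    have hcyl := measurableSet_cylinder m t
    rw [Measure.smul_apply, Measure.smul_apply, Measure.map_apply hTm hcyl,
      Measure.restrict_apply (hTm hcyl), Measure.restrict_apply hcyl, smul_eq_mul, smul_eq_mul]
    by_cases hst : t 0 = s n
    · let u : ℕ → Nielsen r := fun i => if i ≤ n then s i else t (i - n)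
      have hu1 : ∀ i ≤ n, u i = s i := fun i hi => if_pos hi
      have hu2 : ∀ i, u (n + i) = t i := by
        intro i
        rcases Nat.eq_zero_or_pos i with rfl | hi
        · rw [add_zero, hu1 n le_rfl, hst]
        · simp only [u]
          rw [if_neg (by omega), Nat.add_sub_cancel_left]
      have e1 : seqShift^[n] ⁻¹' {ω | ∀ i ≤ m, ω i = t i} ∩ {ω | ∀ i ≤ n, ω i = s i} =
          {ω | ∀ i ≤ n + m, ω i = u i} := by
        ext ω
        simp only [Set.mem_inter_iff, Set.mem_preimage, Set.mem_ofPred_eq, seqShift_iterate]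
        constructor
        · rintro ⟨h1, h2⟩ i hi
          rcases le_total i n with h | h
          · rw [h2 i h, hu1 i h]
          · obtain ⟨j, rfl⟩ := Nat.exists_eq_add_of_le h
            rw [hu2, ← h1 j (by omega), add_comm]
        · intro h
          refine ⟨fun i hi => ?_, fun i hi => ?_⟩
          · rw [add_comm, h _ (by omega), hu2]
          · rw [h i (by omega), hu1 i hi]
      have e2 : {ω : ℕ → Nielsen r | ∀ i ≤ m, ω i = t i} ∩ {ω | ω 0 = s n} = {ω | ∀ i ≤ m, ω i = t i} := by
        refine Set.inter_eq_left.2 fun ω hω => ?_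
        exact (hω 0 (by omega)).trans hst
      rw [e1, e2, walkMeasure_cylinder hr, walkMeasure_cylinder hr, walkMeasure_cylinder hr,
        Finset.prod_range_add, ← hc]
      have p1 : ∏ i ∈ Finset.range n, transProb (u i) (u (i + 1)) =
          ∏ i ∈ Finset.range n, transProb (s i) (s (i + 1)) := by
        refine Finset.prod_congr rfl fun i hi => ?_
        have := Finset.mem_range.1 hi
        rw [hu1 i (by omega), hu1 (i + 1) (by omega)]
      have p2 : ∏ i ∈ Finset.range m, transProb (u (n + i)) (u (n + i + 1)) =
          ∏ i ∈ Finset.range m, transProb (t i) (t (i + 1)) := by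
        refine Finset.prod_congr rfl fun i _ => ?_
        rw [hu2, add_assoc, hu2]
      rw [p1, p2]
      ring
    · have e1 : seqShift^[n] ⁻¹' {ω | ∀ i ≤ m, ω i = t i} ∩ {ω | ∀ i ≤ n, ω i = s i} = ∅ := by
        refine Set.eq_empty_of_forall_notMem fun ω hω => hst ?_
        have h1 := hω.1 0 (by omega)
        rw [seqShift_iterate, zero_add] at h1
        exact h1.symm.trans (hω.2 n le_rfl)
      have e2 : {ω : ℕ → Nielsen r | ∀ i ≤ m, ω i = t i} ∩ {ω | ω 0 = s n} = ∅ :=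
        Set.eq_empty_of_forall_notMem fun ω hω => hst ((hω.1 0 (by omega)).symm.trans hω.2)
      rw [e1, e2]
      simp
  have := congrArg (fun ν : Measure (ℕ → Nielsen r) => ν B) key
  simp only [Measure.smul_apply, smul_eq_mul, Measure.map_apply hTm hB,
    Measure.restrict_apply (hTm hB), Measure.restrict_apply hB] at this
  rwa [Set.inter_comm, Set.inter_comm {ω : ℕ → Nielsen r | ω 0 = s n}]

/-- The Markov shift is ergodic. For an invariant event `A`, the probability of `A` given the first
state is harmonic, hence constant by strong connectivity; so `A` is independent of every cylinder,
and therefore of itself. -/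
theorem ergodic_seqShift (hr : 3 ≤ r) : Ergodic seqShift (walkMeasure r) := by
  have hr2 : 2 ≤ r := by omega
  have := isProbabilityMeasure_walkMeasure hr2
  refine { measurePreserving_seqShift hr2 with aeconst_set := fun A hA hinv => ?_ }
  have hmarkov := fun (s : ℕ → Nielsen r) n => walkMeasure_markov hr2 s n hA
  have hinv_n : ∀ n, seqShift^[n] ⁻¹' A = A := fun n => Function.IsFixedPt.preimage_iterate hinv n
  simp only [hinv_n] at hmarkov
  have hsingle := walkMeasure_single hr2
  set μ := walkMeasure r
  set N : ℝ≥0∞ := ((4 * r * (r - 1) : ℕ) : ℝ≥0∞)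
  have hN0 : N ≠ 0 := by
    refine Nat.cast_ne_zero.2 ?_
    have : 0 < r - 1 := by omega
    positivity
  have hNt : N ≠ ⊤ := ENNReal.natCast_ne_top _
  let h : Nielsen r → ℝ≥0∞ := fun θ => μ ({ω | ω 0 = θ} ∩ A)
  have hsum : ∑ θ, h θ = μ A := by
    have e : A = ⋃ θ : Nielsen r, {ω | ω 0 = θ} ∩ A := by
      ext ω; simp
    conv_rhs => rw [e]
    rw [measure_iUnion _ fun θ => (measurableSet_first θ).inter hA, tsum_fintype]
    intro a b hab
    refine Set.disjoint_left.2 fun ω ha hb => hab ?_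
    exact ha.1.symm.trans hb.1
  have hharm : ∀ θ, h θ = ∑ θ', transProb θ θ' * h θ' := by
    intro θ
    have e : {ω | ω 0 = θ} ∩ A = ⋃ θ' : Nielsen r,
        {ω | ∀ i ≤ 1, ω i = Nat.casesOn i θ fun _ => θ'} ∩ A := by
      ext ω
      simp only [Set.mem_inter_iff, Set.mem_ofPred_eq, Set.mem_iUnion]
      constructor
      · rintro ⟨h0, hω⟩
        refine ⟨ω 1, fun i hi => ?_, hω⟩
        interval_cases i
        · exact h0
        · rfl
      · rintro ⟨θ', h1, hω⟩
        exact ⟨h1 0 (by omega), hω⟩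
    have h1 : ∀ θ', μ ({ω | ∀ i ≤ 1, ω i = Nat.casesOn i θ fun _ => θ'} ∩ A) =
        transProb θ θ' * h θ' := by
      intro θ'
      have h2 := hmarkov (fun i => Nat.casesOn i θ fun _ => θ') 1
      rw [walkMeasure_cylinder hr2 (fun i => Nat.casesOn i θ fun _ => θ')] at h2
      rw [Finset.prod_range_one, mul_assoc] at h2
      exact (ENNReal.mul_right_inj (ENNReal.inv_ne_zero.2 hNt) (ENNReal.inv_ne_top.2 hN0)).1 h2
    simp only [h] at h1 ⊢
    rw [e, measure_iUnion _ fun θ' => (measurableSet_cylinder 1 _).inter hA, tsum_fintype]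
    · exact Finset.sum_congr rfl fun θ' _ => h1 θ'
    · intro a b hab
      refine Set.disjoint_left.2 fun ω ha hb => hab ?_
      exact (ha.1 1 le_rfl).symm.trans (hb.1 1 le_rfl)
  have hconst : ∀ θ θ', h θ = h θ' := by
    intro θ θ'
    have hfin : ∀ θ, h θ ≠ ⊤ := fun θ => measure_ne_top _ _
    refine (ENNReal.toReal_eq_toReal_iff' (hfin θ) (hfin θ')).1 ?_
    refine eq_of_harmonic (P := fun a b => (transProb a b).toReal) (h := fun a => (h a).toReal)
      (fun _ _ => ENNReal.toReal_nonneg) (fun s => ?_) (fun s t => ?_) (fun s => ?_) θ θ'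
    · rw [← ENNReal.toReal_sum fun _ _ => transProb_ne_top _ _, sum_transProb, ENNReal.toReal_one]
    · exact Relation.ReflTransGen.mono (fun a b hab =>
        ENNReal.toReal_pos (transProb_pos hab).ne' (transProb_ne_top _ _)) s t
        (Nielsen.reachable hr s t)
    · rw [hharm s, ENNReal.toReal_sum fun _ _ => ENNReal.mul_ne_top (transProb_ne_top _ _) (hfin _)]
      simp only [ENNReal.toReal_mul]
  have hval : ∀ θ, h θ = N⁻¹ * μ A := by
    intro θ
    have h1 : ∑ θ', h θ' = N * h θ := by
      rw [Finset.sum_congr rfl fun θ' _ => hconst θ' θ, Finset.sum_const, Finset.card_univ,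
        Nielsen.card_eq, nsmul_eq_mul]
    rw [← hsum, h1, ← mul_assoc, ENNReal.inv_mul_cancel hN0 hNt, one_mul]
  have hindep : μ.restrict A = μ A • μ := by
    refine measure_ext_of_cylinder fun n s => ?_
    rw [Measure.restrict_apply (measurableSet_cylinder n s), Measure.smul_apply, smul_eq_mul]
    have h1 := hmarkov s n
    have h2 : μ ({ω | ω 0 = s n} ∩ A) = N⁻¹ * μ A := hval (s n)
    rw [h2, mul_left_comm] at h1
    rw [(ENNReal.mul_right_inj (ENNReal.inv_ne_zero.2 hNt) (ENNReal.inv_ne_top.2 hN0)).1 h1,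
      mul_comm]
  have hsq : μ A = μ A * μ A := by
    have := congrArg (fun ν : Measure (ℕ → Nielsen r) => ν A) hindep
    simpa [Measure.restrict_apply hA] using this
  rw [eventuallyConst_set']
  by_cases h0 : μ A = 0
  · exact Or.inl (ae_eq_empty.2 h0)
  · right
    have h1 : μ A = 1 := by
      have := (ENNReal.mul_right_inj h0 (measure_ne_top μ A) (b := 1) (c := μ A)).1
        (by rw [mul_one, ← hsq])
      exact this.symm
    exact eventuallyEq_univ.2 ((prob_compl_eq_zero_iff hA).2 h1)

end Walk

/-! ### Word length -/

section WordLength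

variable {G : Type*} [Group G] {Q : Set G}

theorem exists_list_length_eq_wordLength (hsymm : ∀ q : G, q ∈ Q ↔ q⁻¹ ∈ Q)
    (hgen : Subgroup.closure Q = ⊤) (g : G) :
    ∃ l : List G, l.length = wordLength Q g ∧ (∀ q ∈ l, q ∈ Q) ∧ l.prod = g := by
  refine Nat.sInf_mem (s := {n : ℕ | ∃ l : List G, l.length = n ∧ (∀ q ∈ l, q ∈ Q) ∧ l.prod = g}) ?_
  have hg : g ∈ Submonoid.closure (Q ∪ Q⁻¹) := by
    rw [← Subgroup.closure_toSubmonoid, hgen]; trivial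
  obtain ⟨l, hl, hg⟩ := Submonoid.exists_list_of_mem_closure hg
  exact ⟨l.length, l, rfl, fun q hq => (hl q hq).elim id (hsymm q).2, hg⟩

theorem wordLength_prod_le {l : List G} (hl : ∀ q ∈ l, q ∈ Q) : wordLength Q l.prod ≤ l.length :=
  Nat.sInf_le ⟨l, rfl, hl, rfl⟩

theorem wordLength_one : wordLength Q (1 : G) = 0 :=
  Nat.le_zero.1 (wordLength_prod_le (Q := Q) (l := []) (by simp))

theorem wordLength_mul_le (hsymm : ∀ q : G, q ∈ Q ↔ q⁻¹ ∈ Q) (hgen : Subgroup.closure Q = ⊤)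
    (g h : G) : wordLength Q (g * h) ≤ wordLength Q g + wordLength Q h := by
  obtain ⟨l, hl, hlQ, rfl⟩ := exists_list_length_eq_wordLength hsymm hgen g
  obtain ⟨m, hm, hmQ, rfl⟩ := exists_list_length_eq_wordLength hsymm hgen h
  rw [← hl, ← hm, ← List.prod_append, ← List.length_append]
  refine wordLength_prod_le fun q hq => ?_
  exact (List.mem_append.1 hq).elim (hlQ q) (hmQ q)

end WordLength

/-! ### Conjugacy length in free groups -/

section ConjNorm

variable {α : Type*} [DecidableEq α]

/-- The length of a shortest element of the conjugacy class of `g`. -/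
noncomputable def conjNorm (g : FreeGroup α) : ℕ := ⨅ c : FreeGroup α, (c * g * c⁻¹).norm

theorem conjNorm_le (g c : FreeGroup α) : conjNorm g ≤ (c * g * c⁻¹).norm :=
  ciInf_le (OrderBot.bddBelow _) c

theorem exists_norm_eq_conjNorm (g : FreeGroup α) : ∃ c, (c * g * c⁻¹).norm = conjNorm g :=
  Nat.sInf_mem (Set.range_nonempty fun c : FreeGroup α => (c * g * c⁻¹).norm)

theorem conjNorm_conj_le (g d : FreeGroup α) : conjNorm (d * g * d⁻¹) ≤ conjNorm g := by
  obtain ⟨c, hc⟩ := exists_norm_eq_conjNorm g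
  rw [← hc]
  refine (conjNorm_le _ (c * d⁻¹)).trans (le_of_eq (congrArg FreeGroup.norm ?_))
  group

/-- If the length of `g` is multiplicative on powers, then `g` is shortest in its conjugacy
class: the powers of a shorter conjugate would grow too slowly. -/
theorem norm_le_conjNorm {g : FreeGroup α} (hg : ∀ m : ℕ, m * g.norm ≤ (g ^ m).norm) :
    g.norm ≤ conjNorm g := by
  obtain ⟨c, hc⟩ := exists_norm_eq_conjNorm g
  set k := conjNorm g
  have hpow : ∀ m : ℕ, ((c * g * c⁻¹) ^ m).norm ≤ m * k := by
    intro m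
    induction m with
    | zero => simp
    | succ m ih =>
      rw [pow_succ, Nat.succ_mul]
      exact (FreeGroup.norm_mul_le _ _).trans (by omega)
  by_contra! h
  have h1 := hg (2 * c.norm + 1)
  have h2 := hpow (2 * c.norm + 1)
  set m := 2 * c.norm + 1 with hm
  have h3 : g ^ m = c⁻¹ * (c * g * c⁻¹) ^ m * c := by
    rw [conj_pow]; group
  have h4 : (g ^ m).norm ≤ c.norm + m * k + c.norm := by
    rw [h3]
    refine (FreeGroup.norm_mul_le _ _).trans (Nat.add_le_add_right ?_ _)
    refine (FreeGroup.norm_mul_le _ _).trans ?_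
    rw [FreeGroup.norm_inv_eq]
    omega
  have h5 : m * (k + 1) ≤ m * g.norm := Nat.mul_le_mul_left _ h
  rw [Nat.mul_succ] at h5
  omega

theorem norm_map_le {β : Type*} [DecidableEq β] (Φ : FreeGroup α →* FreeGroup β) {K : ℕ}
    (hK : ∀ i, (Φ (FreeGroup.of i)).norm ≤ K) (g : FreeGroup α) : (Φ g).norm ≤ K * g.norm := by
  have key : ∀ L : List (α × Bool), (Φ (FreeGroup.mk L)).norm ≤ K * L.length := by
    intro L
    induction L with
    | nil => simp [← FreeGroup.one_eq_mk]
    | cons z L ih =>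
      have h1 : FreeGroup.mk (z :: L) = FreeGroup.mk [z] * FreeGroup.mk L := by
        rw [FreeGroup.mul_mk]; rfl
      have h2 : (Φ (FreeGroup.mk [z])).norm ≤ K := by
        obtain ⟨i, b⟩ := z
        cases b
        · have : (FreeGroup.mk [(i, false)] : FreeGroup α) = (FreeGroup.of i)⁻¹ := by
            simp [FreeGroup.of, FreeGroup.inv_mk, FreeGroup.invRev]
          rw [this, map_inv, FreeGroup.norm_inv_eq]
          exact hK i
        · exact hK i
      rw [h1, map_mul, List.length_cons, Nat.mul_succ]
      exact (FreeGroup.norm_mul_le _ _).trans (by omega)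
  have := key g.toWord
  rwa [FreeGroup.mk_toWord] at this

theorem conjNorm_map_le (Φ : MulAut (FreeGroup α)) {K : ℕ}
    (hK : ∀ i, (Φ (FreeGroup.of i)).norm ≤ K) (g : FreeGroup α) :
    conjNorm (Φ g) ≤ K * conjNorm g := by
  obtain ⟨c, hc⟩ := exists_norm_eq_conjNorm g
  refine (conjNorm_le _ (Φ c)).trans ?_
  rw [← hc, ← map_inv, ← map_mul, ← map_mul]
  exact norm_map_le Φ.toMonoidHom hK _

theorem conjNorm_le_of_coe_eq {Φ Ψ : MulAut (FreeGroup α)}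
    (h : (Φ : OuterAut (FreeGroup α)) = Ψ) (g : FreeGroup α) : conjNorm (Φ g) ≤ conjNorm (Ψ g) := by
  obtain ⟨d, hd⟩ := QuotientGroup.eq.1 h.symm
  have h1 : Φ = Ψ * MulAut.conj d := by rw [hd]; group
  rw [h1, MulAut.mul_apply, MulAut.conj_apply, map_mul, map_mul, map_inv]
  exact conjNorm_conj_le _ _

/-- Conjugacy lengths grow at most exponentially in the word length of an outer automorphism. -/
theorem exists_conjNorm_le_pow_wordLength [Finite α] {Q : Set (OuterAut (FreeGroup α))}
    (hfin : Q.Finite) (hsymm : ∀ q : OuterAut (FreeGroup α), q ∈ Q ↔ q⁻¹ ∈ Q)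
    (hgen : Subgroup.closure Q = ⊤) :
    ∃ K : ℕ, 2 ≤ K ∧ ∀ (Φ : MulAut (FreeGroup α)) (g : FreeGroup α),
      conjNorm (Φ g) ≤ K ^ wordLength Q (Φ : OuterAut (FreeGroup α)) * conjNorm g := by
  obtain ⟨K, hK⟩ := ((hfin.prod (Set.finite_univ (α := α))).image
    fun p => ((Quotient.out p.1 : MulAut (FreeGroup α)) (FreeGroup.of p.2)).norm).bddAbove
  refine ⟨max K 2, le_max_right _ _, fun Φ g => ?_⟩
  obtain ⟨l, hl, hlQ, hprod⟩ := exists_list_length_eq_wordLength hsymm hgen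
    (Φ : OuterAut (FreeGroup α))
  rw [← hl]
  have key : ∀ l : List (OuterAut (FreeGroup α)), (∀ q ∈ l, q ∈ Q) →
      ∃ Ψ : MulAut (FreeGroup α), (Ψ : OuterAut (FreeGroup α)) = l.prod ∧
        conjNorm (Ψ g) ≤ max K 2 ^ l.length * conjNorm g := by
    intro l
    induction l with
    | nil => exact fun _ => ⟨1, rfl, by simp⟩
    | cons q l ih =>
      intro hq
      obtain ⟨Ψ, h1, h2⟩ := ih fun p hp => hq p (List.mem_cons_of_mem _ hp)
      refine ⟨Quotient.out q * Ψ, ?_, ?_⟩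
      · rw [QuotientGroup.mk_mul, h1, List.prod_cons]
        congr 1
        exact Quotient.out_eq q
      · rw [MulAut.mul_apply, List.length_cons, pow_succ', mul_assoc]
        refine (conjNorm_map_le (K := max K 2) _ (fun i => ?_) _).trans (Nat.mul_le_mul_left _ h2)
        exact (hK ⟨(q, i), ⟨hq q List.mem_cons_self, trivial⟩, rfl⟩).trans (le_max_left _ _)
  obtain ⟨Ψ, h1, h2⟩ := key l hlQ
  exact (conjNorm_le_of_coe_eq (hprod.symm.trans h1.symm) g).trans h2

end ConjNorm

/-! ### Nielsen substitutions and legal words -/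

namespace Nielsen

variable {r : ℕ}

/-- The image of a letter under `[x ↦ y x]`, as a word. -/
def substLetter (θ : Nielsen r) (z : Letter r) : List (Letter r) :=
  if z = θ.x then [θ.y, z] else if z = θ.x.inv then [z, θ.y.inv] else [z]

/-- The letter-by-letter image of a word under `[x ↦ y x]`, without cancellation. -/
def substWord (θ : Nielsen r) (l : List (Letter r)) : List (Letter r) :=
  (l.map θ.substLetter).flatten

theorem substWord_append (θ : Nielsen r) (l m : List (Letter r)) :
    θ.substWord (l ++ m) = θ.substWord l ++ θ.substWord m := by
  simp [substWord]

theorem inv_inv (z : Letter r) : z.inv.inv = z := by simp [Letter.inv]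

theorem inv_ne (z : Letter r) : z.inv ≠ z := by
  obtain ⟨i, b⟩ := z
  cases b <;> simp [Letter.inv]

theorem mk_substLetter (θ : Nielsen r) (z : Letter r) :
    FreeGroup.mk (θ.substLetter z) = θ.toAut z.toFree := by
  have hpair : ∀ u v : Letter r, FreeGroup.mk [u, v] = u.toFree * v.toFree := fun u v => by
    rw [Letter.toFree_eq_mk, Letter.toFree_eq_mk, FreeGroup.mul_mk]; rfl
  unfold substLetter
  split_ifs with h1 h2
  · rw [hpair, h1, θ.toAut_spec.1]
  · rw [hpair, h2, Letter.toFree_inv, Letter.toFree_inv, map_inv, θ.toAut_spec.1, mul_inv_rev]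
  · rw [θ.toAut_spec.2 z h1 h2, Letter.toFree_eq_mk]

theorem mk_substWord (θ : Nielsen r) (l : List (Letter r)) :
    FreeGroup.mk (θ.substWord l) = θ.toAut (FreeGroup.mk l) := by
  induction l with
  | nil => simp [substWord, ← FreeGroup.one_eq_mk]
  | cons z l ih =>
    have h1 : FreeGroup.mk (z :: l) = z.toFree * FreeGroup.mk l := by
      rw [Letter.toFree_eq_mk, FreeGroup.mul_mk]; rfl
    rw [h1, map_mul, ← ih, ← mk_substLetter, FreeGroup.mul_mk]
    simp [substWord]

/-- The turn `{u⁻¹, v}` taken by consecutive letters `u, v` of a word is nondegenerate and is not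
the turn `{x, y}`, the only nondegenerate turn folded by `[x ↦ y x]`. -/
def Legal (θ : Nielsen r) (u v : Letter r) : Prop :=
  u.inv ≠ v ∧ ¬(u.inv = θ.x ∧ v = θ.y) ∧ ¬(u.inv = θ.y ∧ v = θ.x)

/-- The initial letter of the image of the letter `z`. -/
def direction (θ : Nielsen r) (z : Letter r) : Letter r := if z = θ.x then θ.y else z

theorem y_ne_x (θ : Nielsen r) : θ.y ≠ θ.x := θ.2.1

theorem direction_ne (θ : Nielsen r) (z : Letter r) : θ.direction z ≠ θ.x := by
  unfold direction
  split_ifs with h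
  · exact θ.y_ne_x
  · exact h

theorem head?_substLetter (θ : Nielsen r) (z : Letter r) :
    (θ.substLetter z).head? = some (θ.direction z) := by
  unfold substLetter direction
  split_ifs <;> rfl

theorem getLast?_substLetter (θ : Nielsen r) (z : Letter r) :
    (θ.substLetter z).getLast? = some (θ.direction z.inv).inv := by
  unfold substLetter direction
  have hx : θ.x.inv ≠ θ.x := inv_ne _
  by_cases h1 : z = θ.x
  · simp [h1, hx, inv_inv]
  · by_cases h2 : z = θ.x.inv
    · simp [h2, hx, inv_inv]
    · have h3 : z.inv ≠ θ.x := fun e => h2 (by rw [← e, inv_inv])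
      simp [h1, h2, h3, inv_inv]

/-- The key cancellation-free property. The images of the letters under `θ = [x ↦ y x]` take only
the turn `{y⁻¹, x}` inside, and turns without the letter `x` where they are joined. The turn
folded by an admissible successor of `θ` contains `x` and differs from `{y⁻¹, x}`. -/
theorem isChain_legal_substWord {θ θ' : Nielsen r} (h : Admissible θ θ') {l : List (Letter r)}
    (hl : l.IsChain θ.Legal) : (θ.substWord l).IsChain θ'.Legal := by
  have hne : ∀ z : Letter r, θ.substLetter z ≠ [] := fun z => by
    unfold substLetter
    split_ifs <;> simp
  have hyx : θ.y.inv ≠ θ.x := fun e => θ.2.2 (by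
    change θ.y = θ.x.inv
    rw [← e, inv_inv])
  have hx' : ∀ a : Letter r, (θ'.x = θ.x ∧ θ'.y = a) ∨ (θ'.y = θ.x ∧ θ'.x = a) → a ≠ θ.y.inv := by
    rintro a (⟨h1, rfl⟩ | ⟨h1, rfl⟩) h2
    · rcases h with ⟨-, h3⟩ | ⟨h3, -⟩
      · exact h3 h2
      · exact θ'.y_ne_x (h3.trans h1.symm)
    · rcases h with ⟨h3, -⟩ | ⟨-, h3⟩
      · exact θ'.y_ne_x (h1.trans h3.symm)
      · exact h3 h2
  unfold substWord
  rw [List.isChain_flatten (by simpa using fun i => ⟨fun _ => hne (i, false), fun _ => hne (i, true)⟩)]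
  constructor
  · intro m hm
    obtain ⟨z, -, rfl⟩ := List.mem_map.1 hm
    unfold substLetter
    split_ifs with h1 h2
    · rw [List.isChain_pair, h1]
      exact ⟨hyx, fun e => hx' _ (Or.inr ⟨e.2.symm, e.1.symm⟩) rfl,
        fun e => hx' _ (Or.inl ⟨e.2.symm, e.1.symm⟩) rfl⟩
    · rw [List.isChain_pair, h2]
      unfold Legal
      rw [inv_inv]
      exact ⟨hyx.symm, fun e => hx' _ (Or.inl ⟨e.1.symm, e.2.symm⟩) rfl,
        fun e => hx' _ (Or.inr ⟨e.1.symm, e.2.symm⟩) rfl⟩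
    · exact List.isChain_singleton _
  · rw [List.isChain_map]
    refine hl.imp fun u v huv a ha b hb => ?_
    rw [getLast?_substLetter, Option.mem_some_iff] at ha
    rw [head?_substLetter, Option.mem_some_iff] at hb
    subst ha hb
    unfold Legal
    rw [inv_inv]
    have hu := θ.direction_ne u.inv
    have hv := θ.direction_ne v
    refine ⟨?_, fun e => ?_, fun e => ?_⟩
    · obtain ⟨h1, h2, h3⟩ := huv
      unfold direction
      split_ifs with h4 h5 h5
      · exact absurd (h4.trans h5.symm) h1
      · exact fun e => h2 ⟨h4, e.symm⟩
      · exact fun e => h3 ⟨e, h5⟩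
      · exact h1
    · rcases h with ⟨h1, -⟩ | ⟨h1, -⟩
      · exact hu (e.1.trans h1)
      · exact hv (e.2.trans h1)
    · rcases h with ⟨h1, -⟩ | ⟨h1, -⟩
      · exact hv (e.2.trans h1)
      · exact hu (e.1.trans h1)

theorem isChain_legal_replicate (θ : Nielsen r) (a : Letter r) (m : ℕ) :
    (List.replicate m a).IsChain θ.Legal := by
  have ha : θ.Legal a a := by
    refine ⟨inv_ne a, fun e => θ.2.2 ?_, fun e => θ.2.2 ?_⟩
    · change θ.y = θ.x.inv
      rw [← e.1, ← e.2, inv_inv]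
    · change θ.y = θ.x.inv
      rw [← e.1, ← e.2]
  exact List.isChain_replicate_of_rel m ha

theorem isReduced_of_isChain_legal {θ : Nielsen r} {l : List (Letter r)}
    (hl : l.IsChain θ.Legal) : FreeGroup.IsReduced l := by
  refine hl.imp fun u v h e => ?_
  by_contra hne
  refine h.1 (Prod.ext e ?_)
  change (!u.2) = v.2
  cases hu : u.2 <;> cases hv : v.2 <;> simp_all

/-- The number of occurrences of the basis element `i` and its inverse in a word. -/
def letterCount (i : Fin r) (l : List (Letter r)) : ℕ := l.countP fun z => z.1 = i

theorem sum_letterCount (l : List (Letter r)) : ∑ i, letterCount i l = l.length := by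
  induction l with
  | nil => simp [letterCount]
  | cons z l ih =>
    simp only [letterCount, List.countP_cons, Finset.sum_add_distrib, List.length_cons] at ih ⊢
    rw [ih]
    simp

theorem length_substWord (θ : Nielsen r) (l : List (Letter r)) :
    (θ.substWord l).length = l.length + letterCount θ.x.1 l := by
  induction l with
  | nil => simp [substWord, letterCount]
  | cons z l ih =>
    have h1 : θ.substWord (z :: l) = θ.substLetter z ++ θ.substWord l := by simp [substWord]
    have h2 : (θ.substLetter z).length = 1 + if z.1 = θ.x.1 then 1 else 0 := by
      by_cases h : z.1 = θ.x.1
      · rw [if_pos h]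
        have : ¬(z ≠ θ.x ∧ z ≠ θ.x.inv) := fun e => (Letter.fst_ne_iff θ.x z).2 e h
        unfold substLetter
        split_ifs with h3 h4
        · rfl
        · rfl
        · exact absurd ⟨h3, h4⟩ this
      · rw [if_neg h]
        have := (Letter.fst_ne_iff θ.x z).1 h
        unfold substLetter
        rw [if_neg this.1, if_neg this.2]
        rfl
    rw [h1, List.length_append, ih, h2, List.length_cons, letterCount, letterCount,
      List.countP_cons]
    simp only [decide_eq_true_eq]
    omega

theorem letterCount_le_substWord (θ : Nielsen r) (i : Fin r) (l : List (Letter r)) :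
    letterCount i l ≤ letterCount i (θ.substWord l) := by
  induction l with
  | nil => simp [letterCount]
  | cons z l ih =>
    have h1 : θ.substWord (z :: l) = θ.substLetter z ++ θ.substWord l := by simp [substWord]
    have h2 : letterCount i [z] ≤ letterCount i (θ.substLetter z) := by
      refine List.Sublist.countP_le ?_
      unfold substLetter
      split_ifs <;> simp
    have h3 : ∀ m n : List (Letter r),
        letterCount i (m ++ n) = letterCount i m + letterCount i n := fun m n => by
      simp [letterCount]
    rw [h1, h3, ← List.singleton_append, h3]
    exact Nat.add_le_add h2 ih

end Nielsen

section Trajectory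

open Nielsen

variable {r : ℕ}

/-- The uncancelled image of the word `l` under `θ_n ∘ ⋯ ∘ θ_1`. -/
def walkWord (ω : ℕ → Nielsen r) (l : List (Letter r)) : ℕ → List (Letter r)
  | 0 => l
  | n + 1 => (ω n).substWord (walkWord ω l n)

/-- The automorphism `θ_n ∘ ⋯ ∘ θ_1`. -/
def walkAut (ω : ℕ → Nielsen r) : ℕ → MulAut (FreeGroup (Fin r))
  | 0 => 1
  | n + 1 => (ω n).toAut * walkAut ω n

theorem coe_walkAut (ω : ℕ → Nielsen r) (n : ℕ) :
    (walkAut ω n : OuterAut (FreeGroup (Fin r))) = walk ω n := by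
  induction n with
  | zero => rfl
  | succ n ih => rw [walkAut, QuotientGroup.mk_mul, ih, walk]

theorem mk_walkWord (ω : ℕ → Nielsen r) (l : List (Letter r)) (n : ℕ) :
    FreeGroup.mk (walkWord ω l n) = walkAut ω n (FreeGroup.mk l) := by
  induction n with
  | zero => rfl
  | succ n ih => rw [walkWord, mk_substWord, ih, walkAut, MulAut.mul_apply]

theorem walkWord_append (ω : ℕ → Nielsen r) (l m : List (Letter r)) (n : ℕ) :
    walkWord ω (l ++ m) n = walkWord ω l n ++ walkWord ω m n := by
  induction n with
  | zero => rfl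
  | succ n ih => rw [walkWord, ih, substWord_append]; rfl

theorem walkWord_nil (ω : ℕ → Nielsen r) (n : ℕ) : walkWord ω [] n = [] := by
  induction n with
  | zero => rfl
  | succ n ih => rw [walkWord, ih]; rfl

theorem length_walkWord_replicate (ω : ℕ → Nielsen r) (a : Letter r) (m n : ℕ) :
    (walkWord ω (List.replicate m a) n).length = m * (walkWord ω [a] n).length := by
  induction m with
  | zero => simp [walkWord_nil]
  | succ m ih =>
    rw [List.replicate_succ, ← List.singleton_append, walkWord_append, List.length_append, ih]
    ring

theorem walkWord_add (ω : ℕ → Nielsen r) (l : List (Letter r)) (m n : ℕ) :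
    walkWord ω l (m + n) = walkWord (seqShift^[m] ω) (walkWord ω l m) n := by
  induction n with
  | zero => rfl
  | succ n ih =>
    rw [← add_assoc, walkWord, ih, walkWord, seqShift_iterate, add_comm n m]

theorem isChain_legal_walkWord {ω : ℕ → Nielsen r} (hω : ∀ n, Admissible (ω n) (ω (n + 1)))
    {l : List (Letter r)} (hl : l.IsChain (ω 0).Legal) (n : ℕ) :
    (walkWord ω l n).IsChain (ω n).Legal := by
  induction n with
  | zero => exact hl
  | succ n ih => exact isChain_legal_substWord (hω n) ih

/-- Along an admissible trajectory the image of a letter is cyclically reduced as it stands. -/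
theorem length_walkWord_le_conjNorm {ω : ℕ → Nielsen r}
    (hω : ∀ n, Admissible (ω n) (ω (n + 1))) (a : Letter r) (n : ℕ) :
    (walkWord ω [a] n).length ≤ conjNorm (walkAut ω n a.toFree) := by
  have hnorm : ∀ m, (FreeGroup.mk (walkWord ω (List.replicate m a) n)).norm =
      m * (walkWord ω [a] n).length := by
    intro m
    have hred := isReduced_of_isChain_legal
      (isChain_legal_walkWord hω (isChain_legal_replicate (ω 0) a m) n)
    rw [FreeGroup.norm, FreeGroup.toWord_mk, hred.reduce_eq, length_walkWord_replicate]
  have hpow : ∀ m, FreeGroup.mk (walkWord ω (List.replicate m a) n) =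
      (walkAut ω n a.toFree) ^ m := by
    intro m
    rw [mk_walkWord, ← map_pow]
    congr 1
    rw [Letter.toFree_eq_mk, FreeGroup.pow_mk]
    congr 1
    simp
  have h1 : (walkAut ω n a.toFree).norm = (walkWord ω [a] n).length := by
    have := hnorm 1
    rw [hpow 1, pow_one, one_mul] at this
    exact this
  rw [← h1]
  refine norm_le_conjNorm fun m => ?_
  rw [← hpow m, hnorm m, h1]

theorem letterCount_le_walkWord (ω : ℕ → Nielsen r) (l : List (Letter r)) (i : Fin r) (n : ℕ) :
    letterCount i l ≤ letterCount i (walkWord ω l n) := by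
  induction n with
  | zero => exact le_rfl
  | succ n ih => exact ih.trans (letterCount_le_substWord _ _ _)

theorem length_add_sum_le_walkWord (ω : ℕ → Nielsen r) (l : List (Letter r)) (n : ℕ) :
    l.length + ∑ j ∈ Finset.range n, letterCount (ω j).x.1 l ≤ (walkWord ω l n).length := by
  induction n with
  | zero => simp [walkWord]
  | succ n ih =>
    rw [Finset.sum_range_succ, walkWord, length_substWord, ← add_assoc]
    exact Nat.add_le_add ih (letterCount_le_walkWord ω l _ n)

theorem length_le_walkWord (ω : ℕ → Nielsen r) (l : List (Letter r)) (n : ℕ) :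
    l.length ≤ (walkWord ω l n).length :=
  (Nat.le_add_right _ _).trans (length_add_sum_le_walkWord ω l n)

/-- Lengths at least double along a block in which each basis element is once replaced. -/
theorem two_mul_length_le_walkWord {ω : ℕ → Nielsen r}
    (hω : ∀ j (hj : j < r), (ω j).x.1 = ⟨j, hj⟩) (l : List (Letter r)) :
    2 * l.length ≤ (walkWord ω l r).length := by
  have h1 := length_add_sum_le_walkWord ω l r
  have h2 : ∑ j ∈ Finset.range r, letterCount (ω j).x.1 l = l.length := by
    rw [← sum_letterCount l, Finset.sum_range]
    exact Finset.sum_congr rfl fun j _ => by rw [hω j j.2]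
  omega

/-- An admissible block in which each basis element is once replaced: `[a_0 ↦ a_1 a_0]` followed by
`[a_j ↦ a_{j-1} a_j]` for `1 ≤ j < r`. -/
theorem exists_doubling_block (hr : 2 ≤ r) : ∃ b : ℕ → Nielsen r,
    (∀ j (hj : j < r), (b j).x.1 = ⟨j, hj⟩) ∧ ∀ j, j + 1 < r → Admissible (b j) (b (j + 1)) := by
  let b : ℕ → Nielsen r := fun j =>
    if h : 0 < j ∧ j < r then
      ofLetters (⟨j, h.2⟩, true) (⟨j - 1, by omega⟩, true) (by simp [Fin.ext_iff]; omega)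
    else ofLetters (⟨0, by omega⟩, true) (⟨1, by omega⟩, true) (by simp)
  have h0 : b 0 = ofLetters (⟨0, by omega⟩, true) (⟨1, by omega⟩, true) (by simp) := dif_neg (by simp)
  have hs : ∀ j (hj : j + 1 < r), b (j + 1) = ofLetters (⟨j + 1, hj⟩, true) (⟨j, by omega⟩, true)
      (by simp [Fin.ext_iff]) := fun j hj => dif_pos ⟨by omega, hj⟩
  have hx : ∀ j (hj : j < r), (b j).x = (⟨j, hj⟩, true) := by
    intro j hj
    cases j with
    | zero => rw [h0]; rfl
    | succ j => rw [hs j hj]; rfl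
  have hy : ∀ j, j < r → (b j).y.2 = true := by
    intro j hj
    cases j with
    | zero => rw [h0]; rfl
    | succ j => rw [hs j hj]; rfl
  refine ⟨b, fun j hj => by rw [hx j hj], fun j hj => Or.inr ⟨?_, fun e => ?_⟩⟩
  · rw [hx j (by omega), hs j hj]; rfl
  · have h1 := congrArg Prod.snd e
    rw [hx (j + 1) hj] at h1
    change true = !(b j).y.2 at h1
    rw [hy j (by omega)] at h1
    simp at h1

open Classical in
/-- Lengths grow exponentially in the number of doubling blocks at times divisible by `r`. -/
theorem two_pow_le_length_walkWord {b : ℕ → Nielsen r}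
    (hb : ∀ j (hj : j < r), (b j).x.1 = ⟨j, hj⟩) (ω : ℕ → Nielsen r) (l : List (Letter r)) (n : ℕ) :
    2 ^ (∑ j ∈ Finset.range n, if ∀ i < r, seqShift^[r * j] ω i = b i then 1 else 0) * l.length ≤
      (walkWord ω l (r * n)).length := by
  induction n with
  | zero => simp [walkWord]
  | succ n ih =>
    rw [Finset.sum_range_succ, Nat.mul_succ, walkWord_add]
    set m := walkWord ω l (r * n)
    split_ifs with h
    · have h1 : 2 * m.length ≤ (walkWord (seqShift^[r * n] ω) m r).length :=
        two_mul_length_le_walkWord (fun j hj => by rw [h j hj, hb j hj]) m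
      rw [pow_succ', mul_assoc]
      omega
    · exact ih.trans (length_le_walkWord _ _ _)

end Trajectory

/-! ### The drift of the walk -/

section Drift

open Nielsen

variable {r : ℕ}

theorem ae_admissible (hr : 2 ≤ r) :
    ∀ᵐ ω ∂walkMeasure r, ∀ n, Admissible (ω n) (ω (n + 1)) := by
  refine ae_all_iff.2 fun n => ?_
  have h0 : ∀ᵐ ω ∂walkMeasure r, Admissible (ω 0) (ω 1) := by
    have h1 : ∀ᵐ ω ∂walkMeasure r, ∀ a b : Nielsen r, ¬Admissible a b →
        ω ∉ {ω : ℕ → Nielsen r | ∀ i ≤ 1, ω i = Nat.casesOn i a fun _ => b} := by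
      refine ae_all_iff.2 fun a => ae_all_iff.2 fun b => ae_all_iff.2 fun hab => ?_
      refine measure_eq_zero_iff_ae_notMem.1 ?_
      rw [walkMeasure_cylinder hr (fun i => Nat.casesOn i a fun _ => b), Finset.prod_range_one]
      change _ * transProb a b = 0
      rw [transProb, if_neg hab, mul_zero]
    filter_upwards [h1] with ω hω
    by_contra h
    refine hω _ _ h fun i hi => ?_
    interval_cases i <;> rfl
  have h2 := ((measurePreserving_seqShift hr).iterate n).quasiMeasurePreserving.ae h0
  filter_upwards [h2] with ω hω
  rwa [seqShift_iterate, seqShift_iterate, zero_add, add_comm] at hω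

theorem measurable_comp_walk (F : OuterAut (FreeGroup (Fin r)) → ℝ) (n : ℕ) :
    Measurable fun ω : ℕ → Nielsen r => F (walk ω n) := by
  induction n generalizing F with
  | zero =>
    simp only [walk]
    exact measurable_const
  | succ n ih =>
    have h1 : Measurable fun p : (ℕ → Nielsen r) × Nielsen r =>
        F ((p.2.toAut : OuterAut (FreeGroup (Fin r))) * walk p.1 n) :=
      measurable_from_prod_countable_left fun θ =>
        ih fun g => F ((θ.toAut : OuterAut (FreeGroup (Fin r))) * g)
    simp only [walk]
    exact h1.comp (g := fun p : (ℕ → Nielsen r) × Nielsen r =>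
      F ((p.2.toAut : OuterAut (FreeGroup (Fin r))) * walk p.1 n))
      (f := fun ω => (ω, ω n)) (measurable_id.prodMk (measurable_pi_apply n))

theorem walk_add (ω : ℕ → Nielsen r) (m n : ℕ) :
    walk ω (m + n) = walk (seqShift^[m] ω) n * walk ω m := by
  induction n with
  | zero => exact (one_mul _).symm
  | succ n ih =>
    rw [← add_assoc, walk, ih, walk, seqShift_iterate, add_comm n m, mul_assoc]

theorem exists_isSubadditiveCocycle_wordLength {Q : Set (OuterAut (FreeGroup (Fin r)))}
    (hsymm : ∀ q : OuterAut (FreeGroup (Fin r)), q ∈ Q ↔ q⁻¹ ∈ Q)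
    (hgen : Subgroup.closure Q = ⊤) :
    ∃ C : ℝ, IsSubadditiveCocycle seqShift
      (fun n (ω : ℕ → Nielsen r) => (wordLength Q (walk ω n) : ℝ)) C := by
  let C : ℕ := Finset.univ.sup fun θ : Nielsen r =>
    wordLength Q (θ.toAut : OuterAut (FreeGroup (Fin r)))
  have hC : ∀ (n : ℕ) (ω : ℕ → Nielsen r), wordLength Q (walk ω n) ≤ C * n := by
    intro n ω
    induction n with
    | zero => simp [walk, wordLength_one]
    | succ n ih =>
      have h1 : wordLength Q ((ω n).toAut : OuterAut (FreeGroup (Fin r))) ≤ C :=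
        Finset.le_sup (f := fun θ : Nielsen r =>
          wordLength Q (θ.toAut : OuterAut (FreeGroup (Fin r)))) (Finset.mem_univ (ω n))
      rw [walk, Nat.mul_succ]
      exact (wordLength_mul_le hsymm hgen _ _).trans (by omega)
  exact ⟨C,
    { measurable := fun n => measurable_comp_walk (fun g => (wordLength Q g : ℝ)) n
      nonneg := fun n ω => Nat.cast_nonneg _
      le := fun n ω => by exact_mod_cast hC n ω
      add_le := fun m n ω => by
        rw [walk_add, add_comm]
        exact_mod_cast wordLength_mul_le hsymm hgen _ _ }⟩

/-- Linear progress in the mean: by stationarity a doubling block occurs at each time divisible by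
`r` with the same positive probability, and word length dominates the logarithm of the length of
the image of a basis element. -/
theorem exists_pos_mul_le_integral_wordLength (hr : 2 ≤ r)
    {Q : Set (OuterAut (FreeGroup (Fin r)))} (hfin : Q.Finite)
    (hsymm : ∀ q : OuterAut (FreeGroup (Fin r)), q ∈ Q ↔ q⁻¹ ∈ Q)
    (hgen : Subgroup.closure Q = ⊤) :
    ∃ ε : ℝ, 0 < ε ∧ ∀ n : ℕ,
      ε * n ≤ ∫ ω, (wordLength Q (walk ω (r * n)) : ℝ) ∂walkMeasure r := by
  classical
  have := isProbabilityMeasure_walkMeasure hr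
  have hT := measurePreserving_seqShift hr
  obtain ⟨C, hf⟩ := exists_isSubadditiveCocycle_wordLength hsymm hgen
  obtain ⟨K, hK2, hK⟩ := exists_conjNorm_le_pow_wordLength hfin hsymm hgen
  obtain ⟨b, hb, hadm⟩ := exists_doubling_block hr
  let B : Set (ℕ → Nielsen r) := {ω | ∀ i ≤ r - 1, ω i = b i}
  have hBm : MeasurableSet B := measurableSet_cylinder _ _
  have hBpos : 0 < (walkMeasure r).real B := by
    refine ENNReal.toReal_pos (ne_of_gt ?_) (measure_ne_top _ _)
    change 0 < walkMeasure r {ω | ∀ i ≤ r - 1, ω i = b i}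
    rw [walkMeasure_cylinder hr]
    refine ENNReal.mul_pos (ENNReal.inv_ne_zero.2 (ENNReal.natCast_ne_top _)) ?_
    refine Finset.prod_ne_zero_iff.2 fun i hi => (transProb_pos (hadm i ?_)).ne'
    have := Finset.mem_range.1 hi
    omega
  have hlogK : 0 < Real.log K := Real.log_pos (by exact_mod_cast hK2)
  have hlog2 : 0 < Real.log 2 := Real.log_pos (by norm_num)
  let a : Letter r := (⟨0, by omega⟩, true)
  refine ⟨(walkMeasure r).real B * Real.log 2 / Real.log K, by positivity, fun n => ?_⟩
  have hpt : ∀ᵐ ω ∂walkMeasure r, Real.log 2 / Real.log K *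
      ∑ j ∈ Finset.range n, B.indicator (1 : (ℕ → Nielsen r) → ℝ) (seqShift^[r * j] ω) ≤
      (wordLength Q (walk ω (r * n)) : ℝ) := by
    filter_upwards [ae_admissible hr] with ω hω
    have h1 := two_pow_le_length_walkWord hb ω [a] n
    have h2 := length_walkWord_le_conjNorm hω a (r * n)
    have h3 := hK (walkAut ω (r * n)) a.toFree
    rw [coe_walkAut] at h3
    have h4 : conjNorm a.toFree ≤ 1 := by
      refine (conjNorm_le _ 1).trans (le_of_eq ?_)
      simp [a, Letter.toFree]
    set D := ∑ j ∈ Finset.range n, if ∀ i < r, seqShift^[r * j] ω i = b i then 1 else 0 with hD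
    have h5 : 2 ^ D ≤ K ^ wordLength Q (walk ω (r * n)) := by
      rw [List.length_singleton, mul_one] at h1
      exact h1.trans (h2.trans (h3.trans ((Nat.mul_le_mul_left _ h4).trans (mul_one _).le)))
    have h6 : ∑ j ∈ Finset.range n, B.indicator (1 : (ℕ → Nielsen r) → ℝ) (seqShift^[r * j] ω) =
        (D : ℝ) := by
      rw [hD, Nat.cast_sum]
      refine Finset.sum_congr rfl fun j _ => ?_
      have hiff : seqShift^[r * j] ω ∈ B ↔ ∀ i < r, seqShift^[r * j] ω i = b i :=
        forall_congr' fun i => by rw [show i ≤ r - 1 ↔ i < r by omega]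
      by_cases h : seqShift^[r * j] ω ∈ B
      · rw [Set.indicator_of_mem h, if_pos (hiff.1 h)]
        simp
      · rw [Set.indicator_of_notMem h, if_neg fun h' => h (hiff.2 h')]
        simp
    rw [h6, div_mul_eq_mul_div, div_le_iff₀ hlogK]
    have h7 : Real.log ((2 : ℝ) ^ D) ≤ Real.log ((K : ℝ) ^ wordLength Q (walk ω (r * n))) :=
      Real.log_le_log (by positivity) (by exact_mod_cast h5)
    rw [Real.log_pow, Real.log_pow] at h7
    linarith
  have hBi : Integrable (B.indicator (1 : (ℕ → Nielsen r) → ℝ)) (walkMeasure r) :=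
    (integrable_const (1 : ℝ)).indicator hBm
  have hi : ∀ j ∈ Finset.range n, Integrable
      (fun ω => B.indicator (1 : (ℕ → Nielsen r) → ℝ) (seqShift^[r * j] ω)) (walkMeasure r) :=
    fun j _ => hT.integrable_comp_iterate hBi _
  have h8 := integral_mono_ae ((integrable_finsetSum _ hi).const_mul _) (hf.integrable _ (r * n)) hpt
  refine le_trans (le_of_eq ?_) h8
  rw [integral_const_mul, integral_finsetSum _ hi]
  simp only [hT.integral_comp_iterate (measurable_one.indicator hBm),
    integral_indicator_one hBm]
  simp
  ring

end Drift

theorem theorem4p15 (r : ℕ) (hr : 3 ≤ r) (Q : Set (OuterAut (FreeGroup (Fin r))))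
    (hfin : Q.Finite) (hsymm : ∀ q : OuterAut (FreeGroup (Fin r)), q ∈ Q ↔ q⁻¹ ∈ Q)
    (hgen : Subgroup.closure Q = ⊤) :
    ∃ c : ℝ, 0 < c ∧ ∀ᵐ ω ∂(walkMeasure r),
      Tendsto (fun n : ℕ => (1 / (n : ℝ)) * (wordLength Q (walk ω n) : ℝ)) atTop (𝓝 c) := by
  have hr2 : 2 ≤ r := by omega
  have := isProbabilityMeasure_walkMeasure hr2
  have hT := ergodic_seqShift hr
  obtain ⟨C, hf⟩ := exists_isSubadditiveCocycle_wordLength hsymm hgen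
  obtain ⟨ε, hε, hint⟩ := exists_pos_mul_le_integral_wordLength hr2 hfin hsymm hgen
  have hr0 : (0 : ℝ) < r := by exact_mod_cast (by omega : 0 < r)
  refine ⟨hf.rate hT.toMeasurePreserving, ?_, ?_⟩
  · have hsub : Tendsto (fun n : ℕ => r * n) atTop atTop :=
      tendsto_id.const_mul_atTop' (by omega)
    have h1 := (hf.tendsto_integral_div hT.toMeasurePreserving).comp hsub
    refine lt_of_lt_of_le (div_pos hε hr0) (ge_of_tendsto h1 ?_)
    filter_upwards [eventually_gt_atTop 0] with n hn
    have hn' : (0 : ℝ) < n := by exact_mod_cast hn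
    simp only [Function.comp_apply, Nat.cast_mul]
    rw [div_le_div_iff₀ hr0 (by positivity)]
    nlinarith [hint n]
  · filter_upwards [hf.ae_tendsto_div hT] with ω hω
    refine hω.congr fun n => ?_
    rw [one_div, inv_mul_eq_div]
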